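/- Let $n\ge 0$ and $d\ge 1$ be integers, let $(\Omega_i,\mu_i)$, $i=1,\dots,n$, be probability spaces, and let $\mu=\mu_1\otimes\cdots\otimes\mu_n$ be the product measure on $\Omega=\Omega_1\times\cdots\times\Omega_n$. Let $\mathbb{H}_d$ be the space of $d\times d$ complex Hermitian matrices, with smallest and largest eigenvalues $\lambda_{\min},\lambda_{\max}$ and with the $\ell_2$ operator norm $\|\cdot\|$. Let $f:\Omega\to\mathbb{H}_d$ be $\mu$-integrable (entrywise), with entrywise expectation $\mathbb{E}_\mu f$. For $z,w\in\Omega$ write $(z;w)_i=(z^1,\dots,z^{i-1},w^i,z^{i+1},\dots,z^n)$, and assume that, for $\mu$-almost every $z$, the random matrices $\big(f(z)-f((z;Z)_i)\big)^2$, $i=1,\dots,n$, with $Z\sim\mu$, are integrable (entrywise), so that the matrix $$V(f)(z)=\frac12\sum_{i=1}^n\mathbb{E}_{Z\sim\mu}\Big[\big(f(z)-f((z;Z)_i)\big)^2\Big]$$ is defined. Define $v_f=\big\|\,\|V(f)\|\,\big\|_{L_\infty(\mu)}\in[0,\infty]$. Then, for all $t\ge 0$, $$\mathbb{P}_\mu\{\lambda_{\max}(f-\mathbb{E}_\mu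 f)\ge t\}\le d\cdot\exp\Big(-\frac{t^2}{4v_f}\Big),\qquad \mathbb{P}_\mu\{\lambda_{\min}(f-\mathbb{E}_\mu f)\le -t\}\le d\cdot\exp\Big(-\frac{t^2}{4v_f}\Big).$$ Furthermore, $\lambda_{\max}(f-\mathbb{E}_\mu f)$ and $\lambda_{\min}(f-\mathbb{E}_\mu f)$ are $\mu$-integrable, and $$\mathbb{E}_\mu\lambda_{\max}(f-\mathbb{E}_\mu f)\le 2\sqrt{v_f\log d},\qquad \mathbb{E}_\mu\lambda_{\min}(f-\mathbb{E}_\mu f)\ge -2\sqrt{v_f\log d}.$$ Here $t^2/\infty=0$, $t^2/0=\infty$ for $t>0$, $0/0=0$, $\exp(-\infty)=0$, and $\infty\cdot 0=0$. -/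

import Mathlib

open MeasureTheory
open scoped ENNReal

noncomputable section

namespace ProductMatrix

/-- The largest eigenvalue of a Hermitian matrix: the maximum of its (real) spectrum. -/
def lambdaMax {d : ℕ} (A : Matrix (Fin d) (Fin d) ℂ) : ℝ :=
  sSup (spectrum ℝ A)

/-- The smallest eigenvalue of a Hermitian matrix: the minimum of its (real) spectrum. -/
def lambdaMin {d : ℕ} (A : Matrix (Fin d) (Fin d) ℂ) : ℝ :=
  sInf (spectrum ℝ A)

/-- The entrywise expectation of a random matrix. -/
def expect {d : ℕ} {Ω : Type*} [MeasurableSpace Ω] (μ : Measure Ω)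
    (X : Ω → Matrix (Fin d) (Fin d) ℂ) : Matrix (Fin d) (Fin d) ℂ :=
  Matrix.of fun a b => ∫ z, X z a b ∂μ

/-- The entrywise integrability of a random matrix. -/
def EntryIntegrable {d : ℕ} {Ω : Type*} [MeasurableSpace Ω] (μ : Measure Ω)
    (X : Ω → Matrix (Fin d) (Fin d) ℂ) : Prop :=
  ∀ a b, Integrable (fun z => X z a b) μ

variable {n d : ℕ} {Ω : Fin n → Type*} [∀ i, MeasurableSpace (Ω i)]

/-- The squared increment `(f(z) - f((z;w)_i))²`, where `(z;w)_i` is `z` with its `i`-th coordinate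
replaced by that of `w`. -/
def sqIncrement (f : (∀ i, Ω i) → Matrix (Fin d) (Fin d) ℂ) (i : Fin n) (z w : ∀ i, Ω i) :
    Matrix (Fin d) (Fin d) ℂ :=
  (f z - f (Function.update z i (w i))) ^ 2

/-- The matrix variance proxy
`V(f)(z) = (1/2) ∑ᵢ E_Z (f(z) - f((z;Z)_i))²` with `Z` distributed as `⨂ᵢ μᵢ`. -/
def varianceMatrix (μ : ∀ i, Measure (Ω i)) (f : (∀ i, Ω i) → Matrix (Fin d) (Fin d) ℂ)
    (z : ∀ i, Ω i) : Matrix (Fin d) (Fin d) ℂ :=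
  (1 / 2 : ℂ) • ∑ i, expect (Measure.pi μ) (fun w => sqIncrement f i z w)

/-- The scalar variance proxy `v_f`: the essential supremum, in `[0, ∞]`, of the `ℓ₂` operator norm
of `V(f)`. -/
def varianceProxy (μ : ∀ i, Measure (Ω i)) (f : (∀ i, Ω i) → Matrix (Fin d) (Fin d) ℂ) : ℝ≥0∞ :=
  essSup (fun z => ‖Matrix.toEuclideanCLM (n := Fin d) (𝕜 := ℂ) (varianceMatrix μ f z)‖ₑ)
    (Measure.pi μ)

/-- The tail bound `d · exp(-t² / (4v)) ∈ [0, ∞]` for `t ≥ 0` and `v ∈ [0, ∞]`. The division is that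
of `[0, ∞]`, so `t² / ∞ = 0`, and `t² / 0 = ∞` for `t > 0` (where the bound is `d · exp(-∞) = 0`),
and `0 / 0 = 0`. -/
def tailBound (d : ℕ) (v : ℝ≥0∞) (t : ℝ) : ℝ≥0∞ :=
  d * EReal.exp (-((ENNReal.ofReal (t ^ 2) / (4 * v) : ℝ≥0∞) : EReal))

/-- The expectation bound `2 √(v log d) ∈ [0, ∞]` for `d ≥ 1` and `v ∈ [0, ∞]`, with `∞ · 0 = 0`. -/
def expectationBound (d : ℕ) (v : ℝ≥0∞) : ℝ≥0∞ :=
  2 * (v * ENNReal.ofReal (Real.log d)) ^ (1 / 2 : ℝ)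

end ProductMatrix

end

/-!
Write `X = f - E f` and consider the exponential moment `u θ = E tr exp (θ X)`. The inequality
`|eˣ - eʸ| ≤ |x - y| (eˣ + eʸ) / 2`, read off in eigenbases of two Hermitian matrices, bounds
`tr (U (exp A - exp B))` by Gaussian-type energies of `U` and `A - B`. To apply it, take an
independent copy of the sample and interpolate by resampling every coordinate with probability `t`:
by Russo's formula the derivative in `t` is a sum over single-coordinate resamplings, and exchanging
the two copies turns every energy into one governed by `V(f)`. This gives `u' ≤ 2 v_f θ u`, hence
`u θ ≤ d exp (v_f θ²)`, and the tail and expectation bounds follow by Chernoff and Jensen.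

The exponential moments are finite because `f` is essentially bounded as soon as `v_f < ∞`:
replacing the coordinates of `z` one at a time by those of an independent copy moves `f z` by a
bounded amount in mean at each step.
-/

noncomputable section

open scoped NNReal Matrix.Norms.L2Operator symmDiff

namespace ProductMatrix

section MatrixAnalysis

variable {m : Type*} [Fintype m]

/-- The real part of the trace, as a continuous real-linear functional. -/
def reTrace : Matrix m m ℂ →L[ℝ] ℝ :=
  (Complex.reLm ∘ₗ Matrix.traceLinearMap m ℝ ℂ).toContinuousLinearMap

theorem reTrace_apply (M : Matrix m m ℂ) : reTrace M = M.trace.re := rfl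

theorem reTrace_mul_comm (M N : Matrix m m ℂ) : reTrace (M * N) = reTrace (N * M) := by
  rw [reTrace_apply, reTrace_apply, Matrix.trace_mul_comm]

variable [DecidableEq m]

@[fun_prop]
theorem continuous_matrix_exp : Continuous (NormedSpace.exp : Matrix m m ℂ → Matrix m m ℂ) := by
  let _ : NormedAlgebra ℚ (Matrix m m ℂ) := NormedAlgebra.restrictScalars ℚ ℂ _
  exact NormedSpace.exp_continuous

variable {A B : Matrix m m ℂ}

section EigenCoord

variable (hA : A.IsHermitian) (hB : B.IsHermitian)

/-- The matrix of the operator `M` with respect to an orthonormal eigenbasis of `B` in the source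
and an orthonormal eigenbasis of `A` in the target. -/
def eigenCoord (M : Matrix m m ℂ) : Matrix m m ℂ :=
  star (hA.eigenvectorUnitary : Matrix m m ℂ) * M * hB.eigenvectorUnitary

theorem eigenCoord_self_one : eigenCoord hA hA 1 = 1 := by
  simp [eigenCoord]

theorem eigenCoord_sub (M N : Matrix m m ℂ) :
    eigenCoord hA hB (M - N) = eigenCoord hA hB M - eigenCoord hA hB N := by
  simp only [eigenCoord, mul_sub, sub_mul]

theorem eigenCoord_cfc_mul (φ : ℝ → ℝ) (M : Matrix m m ℂ) (i j : m) :
    eigenCoord hA hB (cfc φ A * M) i j = φ (hA.eigenvalues i) * eigenCoord hA hB M i j := by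
  have : eigenCoord hA hB (cfc φ A * M) =
      Matrix.diagonal (RCLike.ofReal ∘ φ ∘ hA.eigenvalues) * eigenCoord hA hB M := by
    rw [hA.cfc_eq, Matrix.IsHermitian.cfc, Unitary.conjStarAlgAut_apply, eigenCoord, eigenCoord]
    simp only [← mul_assoc, Unitary.coe_star_mul_self, one_mul]
  rw [this, Matrix.diagonal_mul]
  rfl

theorem eigenCoord_mul_cfc (φ : ℝ → ℝ) (M : Matrix m m ℂ) (i j : m) :
    eigenCoord hA hB (M * cfc φ B) i j = φ (hB.eigenvalues j) * eigenCoord hA hB M i j := by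
  have : eigenCoord hA hB (M * cfc φ B) =
      eigenCoord hA hB M * Matrix.diagonal (RCLike.ofReal ∘ φ ∘ hB.eigenvalues) := by
    rw [hB.cfc_eq, Matrix.IsHermitian.cfc, Unitary.conjStarAlgAut_apply, eigenCoord, eigenCoord]
    simp only [mul_assoc, Unitary.coe_star_mul_self, mul_one]
  rw [this, Matrix.mul_diagonal, mul_comm]
  rfl

theorem reTrace_star_mul_eq_sum_eigenCoord (M N : Matrix m m ℂ) :
    reTrace (star M * N) =
      ∑ i, ∑ j, (star (eigenCoord hA hB M i j) * eigenCoord hA hB N i j).re := by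
  have hP := Unitary.mul_star_self_of_mem hA.eigenvectorUnitary.2
  have hQ := Unitary.mul_star_self_of_mem hB.eigenvectorUnitary.2
  have h : reTrace (star M * N) =
      reTrace (star (eigenCoord hA hB M) * eigenCoord hA hB N) := by
    simp only [eigenCoord, star_mul, star_star, mul_assoc]
    rw [← mul_assoc (hA.eigenvectorUnitary : Matrix m m ℂ), hP, one_mul,
      reTrace_mul_comm (star (hB.eigenvectorUnitary : Matrix m m ℂ)), mul_assoc, mul_assoc, hQ,
      mul_one]
  rw [h, Finset.sum_comm]
  simp only [reTrace_apply, Matrix.trace, Matrix.diag_apply, Matrix.mul_apply, Matrix.star_apply,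
    Complex.re_sum]

theorem reTrace_mul_cfc (V : Matrix m m ℂ) (φ : ℝ → ℝ) :
    reTrace (V * cfc φ A) = ∑ i, φ (hA.eigenvalues i) * (eigenCoord hA hA V i i).re := by
  rw [← one_mul (V * cfc φ A), ← star_one, reTrace_star_mul_eq_sum_eigenCoord hA hA]
  refine Finset.sum_congr rfl fun i _ => ?_
  rw [Finset.sum_eq_single i (fun j _ hj => by simp [eigenCoord_self_one, hj.symm]) (by simp),
    eigenCoord_self_one, eigenCoord_mul_cfc, Matrix.one_apply_eq, star_one, one_mul,
    Complex.re_ofReal_mul]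

theorem reTrace_cfc (φ : ℝ → ℝ) : reTrace (cfc φ A) = ∑ i, φ (hA.eigenvalues i) := by
  simpa [eigenCoord_self_one] using reTrace_mul_cfc hA 1 φ

theorem reTrace_sq_mul_cfc_left {M : Matrix m m ℂ} (hM : M.IsHermitian) (φ : ℝ → ℝ) :
    reTrace (M ^ 2 * cfc φ A) =
      ∑ i, ∑ j, φ (hA.eigenvalues i) * ‖eigenCoord hA hB M i j‖ ^ 2 := by
  have h : reTrace (M ^ 2 * cfc φ A) = reTrace (star M * (cfc φ A * M)) := by
    rw [hM.isSelfAdjoint.star_eq, sq, mul_assoc, reTrace_mul_comm, mul_assoc]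
  rw [h, reTrace_star_mul_eq_sum_eigenCoord hA hB]
  refine Finset.sum_congr rfl fun i _ => Finset.sum_congr rfl fun j _ => ?_
  rw [eigenCoord_cfc_mul, mul_left_comm, Complex.re_ofReal_mul, Complex.star_def, Complex.conj_mul',
    ← Complex.ofReal_pow, Complex.ofReal_re]

theorem reTrace_sq_mul_cfc_right {M : Matrix m m ℂ} (hM : M.IsHermitian) (φ : ℝ → ℝ) :
    reTrace (M ^ 2 * cfc φ B) =
      ∑ i, ∑ j, φ (hB.eigenvalues j) * ‖eigenCoord hA hB M i j‖ ^ 2 := by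
  have h : reTrace (M ^ 2 * cfc φ B) = reTrace (star M * (M * cfc φ B)) := by
    rw [hM.isSelfAdjoint.star_eq, ← mul_assoc, ← sq]
  rw [h, reTrace_star_mul_eq_sum_eigenCoord hA hB]
  refine Finset.sum_congr rfl fun i _ => Finset.sum_congr rfl fun j _ => ?_
  rw [eigenCoord_mul_cfc, mul_left_comm, Complex.re_ofReal_mul, Complex.star_def, Complex.conj_mul',
    ← Complex.ofReal_pow, Complex.ofReal_re]

theorem norm_apply_le_norm (M : Matrix m m ℂ) (i j : m) : ‖M i j‖ ≤ ‖M‖ := by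
  have h := M.l2_opNorm_mulVec (EuclideanSpace.single j (1 : ℂ))
  rw [PiLp.norm_single, norm_one, mul_one] at h
  refine le_trans (le_of_eq ?_) ((PiLp.norm_apply_le _ i).trans h)
  simp

theorem norm_eigenCoord (M : Matrix m m ℂ) : ‖eigenCoord hA hB M‖ = ‖M‖ := by
  rw [eigenCoord, CStarRing.norm_mul_mem_unitary _ hB.eigenvectorUnitary.2,
    CStarRing.norm_mem_unitary_mul _ (Unitary.star_mem hA.eigenvectorUnitary.2)]

end EigenCoord

theorem reTrace_sq_mul_cfc_nonneg (hA : A.IsHermitian) {M : Matrix m m ℂ} (hM : M.IsHermitian)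
    {φ : ℝ → ℝ} (hφ : ∀ x, 0 ≤ φ x) : 0 ≤ reTrace (M ^ 2 * cfc φ A) := by
  rw [reTrace_sq_mul_cfc_left hA hA hM]
  exact Finset.sum_nonneg fun i _ => Finset.sum_nonneg fun j _ =>
    mul_nonneg (hφ _) (sq_nonneg _)

theorem reTrace_mul_cfc_le (hA : A.IsHermitian) (V : Matrix m m ℂ) {φ : ℝ → ℝ}
    (hφ : ∀ x, 0 ≤ φ x) :
    reTrace (V * cfc φ A) ≤ ‖V‖ * reTrace (cfc φ A) := by
  rw [reTrace_mul_cfc hA, reTrace_cfc hA, Finset.mul_sum]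
  refine Finset.sum_le_sum fun i _ => ?_
  rw [mul_comm ‖V‖]
  refine mul_le_mul_of_nonneg_left ((Complex.re_le_norm _).trans ?_) (hφ _)
  exact (norm_apply_le_norm _ i i).trans_eq (norm_eigenCoord hA hA V)

theorem eigenCoord_cfc_sub_cfc (hA : A.IsHermitian) (hB : B.IsHermitian) (φ : ℝ → ℝ) (i j : m) :
    eigenCoord hA hB (cfc φ A - cfc φ B) i j =
      ((φ (hA.eigenvalues i) - φ (hB.eigenvalues j) : ℝ) : ℂ) * eigenCoord hA hB 1 i j := by
  rw [← mul_one (cfc φ A), ← one_mul (cfc φ B), eigenCoord_sub, Matrix.sub_apply,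
    eigenCoord_cfc_mul, eigenCoord_mul_cfc, Complex.ofReal_sub, sub_mul]

theorem eigenCoord_sub_eq_mul (hA : A.IsHermitian) (hB : B.IsHermitian) (i j : m) :
    eigenCoord hA hB (A - B) i j =
      ((hA.eigenvalues i - hB.eigenvalues j : ℝ) : ℂ) * eigenCoord hA hB 1 i j := by
  have h := eigenCoord_cfc_sub_cfc hA hB id i j
  rwa [cfc_id ℝ A hA.isSelfAdjoint, cfc_id ℝ B hB.isSelfAdjoint] at h

theorem two_mul_mul_le_mul_sq_add {s : ℝ} (hs : 0 < s) (x y : ℝ) :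
    2 * (x * y) ≤ s * x ^ 2 + s⁻¹ * y ^ 2 := by
  have h : s * x ^ 2 + s⁻¹ * y ^ 2 - 2 * (x * y) = s⁻¹ * (s * x - y) ^ 2 := by
    field_simp
    ring
  rw [← sub_nonneg, h]
  positivity

/-- In coordinates with respect to the eigenbases of `A` and `B` the inequality holds entrywise. -/
theorem reTrace_mul_cfc_sub_cfc_le (hA : A.IsHermitian) (hB : B.IsHermitian)
    {U : Matrix m m ℂ} (hU : U.IsHermitian) {φ ψ : ℝ → ℝ}
    (hφ : ∀ x y, |φ x - φ y| ≤ |x - y| * ((ψ x + ψ y) / 2)) (hψ : ∀ x, 0 ≤ ψ x)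
    {s : ℝ} (hs : 0 < s) :
    reTrace (U * (cfc φ A - cfc φ B)) ≤
      (s * (reTrace (U ^ 2 * cfc ψ A) + reTrace (U ^ 2 * cfc ψ B)) +
        s⁻¹ * (reTrace ((A - B) ^ 2 * cfc ψ A) + reTrace ((A - B) ^ 2 * cfc ψ B))) / 4 := by
  rw [← hU.isSelfAdjoint.star_eq, reTrace_star_mul_eq_sum_eigenCoord hA hB,
    hU.isSelfAdjoint.star_eq, reTrace_sq_mul_cfc_left hA hB hU, reTrace_sq_mul_cfc_right hA hB hU,
    reTrace_sq_mul_cfc_left hA hB (hA.sub hB), reTrace_sq_mul_cfc_right hA hB (hA.sub hB)]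
  simp only [← Finset.sum_add_distrib, Finset.mul_sum, Finset.sum_div]
  refine Finset.sum_le_sum fun i _ => Finset.sum_le_sum fun j _ => ?_
  rw [eigenCoord_cfc_sub_cfc, eigenCoord_sub_eq_mul]
  set a := hA.eigenvalues i
  set b := hB.eigenvalues j
  set u := eigenCoord hA hB U i j
  set w := eigenCoord hA hB 1 i j
  calc (star u * (((φ a - φ b : ℝ) : ℂ) * w)).re
      ≤ ‖u‖ * (|φ a - φ b| * ‖w‖) := by
        refine (Complex.re_le_norm _).trans_eq ?_
        rw [norm_mul, norm_mul, norm_star, Complex.norm_real, Real.norm_eq_abs]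
    _ ≤ ‖u‖ * (|a - b| * ((ψ a + ψ b) / 2) * ‖w‖) := by gcongr; exact hφ _ _
    _ = (ψ a + ψ b) * (2 * (‖u‖ * (|a - b| * ‖w‖))) / 4 := by ring
    _ ≤ (ψ a + ψ b) * (s * ‖u‖ ^ 2 + s⁻¹ * (|a - b| * ‖w‖) ^ 2) / 4 := by
        gcongr
        · exact add_nonneg (hψ _) (hψ _)
        · exact two_mul_mul_le_mul_sq_add hs _ _
    _ = _ := by
        rw [norm_mul, Complex.norm_real, Real.norm_eq_abs]
        ring

theorem sinh_le_mul_cosh {t : ℝ} (ht : 0 ≤ t) : Real.sinh t ≤ t * Real.cosh t := by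
  have hderiv (y : ℝ) : HasDerivAt (fun y => y * Real.cosh y - Real.sinh y) (y * Real.sinh y) y :=
    (((hasDerivAt_id' y).mul (Real.hasDerivAt_cosh y)).sub (Real.hasDerivAt_sinh y)).congr_deriv
      (by ring)
  have hmono : MonotoneOn (fun y => y * Real.cosh y - Real.sinh y) (Set.Ici 0) := by
    refine monotoneOn_of_deriv_nonneg (convex_Ici 0) (by fun_prop) (by fun_prop) fun y hy => ?_
    rw [interior_Ici] at hy
    rw [(hderiv y).deriv]
    exact mul_nonneg hy.le (Real.sinh_nonneg_iff.2 hy.le)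
  simpa using hmono Set.self_mem_Ici ht ht

theorem abs_exp_sub_exp_le (x y : ℝ) :
    |Real.exp x - Real.exp y| ≤ |x - y| * ((Real.exp x + Real.exp y) / 2) := by
  wlog hyx : y ≤ x generalizing x y
  · rw [abs_sub_comm, abs_sub_comm x, add_comm]
    exact this y x (le_of_not_ge hyx)
  have hexp (t : ℝ) : Real.exp t = Real.exp ((x + y) / 2) * Real.exp (t - (x + y) / 2) := by
    rw [← Real.exp_add, add_sub_cancel]
  set t := (x - y) / 2 with ht
  have hx : x - (x + y) / 2 = t := by ring
  have hy : y - (x + y) / 2 = -t := by ring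
  have hsinh : Real.sinh t ≤ t * Real.cosh t := sinh_le_mul_cosh (by linarith)
  rw [abs_of_nonneg (sub_nonneg.2 (Real.exp_le_exp.2 hyx)), abs_of_nonneg (sub_nonneg.2 hyx),
    hexp x, hexp y, hx, hy]
  rw [Real.sinh_eq, Real.cosh_eq] at hsinh
  linear_combination 2 * Real.exp ((x + y) / 2) * hsinh

theorem exp_eq_cfc (hA : A.IsHermitian) : NormedSpace.exp A = cfc Real.exp A :=
  (CFC.real_exp_eq_normedSpace_exp hA.isSelfAdjoint).symm

theorem reTrace_mul_exp_sub_exp_le (hA : A.IsHermitian) (hB : B.IsHermitian)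
    {U : Matrix m m ℂ} (hU : U.IsHermitian) {s : ℝ} (hs : 0 < s) :
    reTrace (U * (NormedSpace.exp A - NormedSpace.exp B)) ≤
      (s * (reTrace (U ^ 2 * NormedSpace.exp A) + reTrace (U ^ 2 * NormedSpace.exp B)) +
        s⁻¹ * (reTrace ((A - B) ^ 2 * NormedSpace.exp A) +
          reTrace ((A - B) ^ 2 * NormedSpace.exp B))) / 4 := by
  rw [exp_eq_cfc hA, exp_eq_cfc hB]
  exact reTrace_mul_cfc_sub_cfc_le hA hB hU abs_exp_sub_exp_le (fun x => (Real.exp_pos x).le) hs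

theorem reTrace_sq_mul_exp_nonneg (hA : A.IsHermitian) {M : Matrix m m ℂ} (hM : M.IsHermitian) :
    0 ≤ reTrace (M ^ 2 * NormedSpace.exp A) := by
  rw [exp_eq_cfc hA]
  exact reTrace_sq_mul_cfc_nonneg hA hM fun x => (Real.exp_pos x).le

theorem reTrace_mul_exp_le (hA : A.IsHermitian) (V : Matrix m m ℂ) :
    reTrace (V * NormedSpace.exp A) ≤ ‖V‖ * reTrace (NormedSpace.exp A) := by
  rw [exp_eq_cfc hA]
  exact reTrace_mul_cfc_le hA V fun x => (Real.exp_pos x).le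

theorem reTrace_exp_nonneg (hA : A.IsHermitian) : 0 ≤ reTrace (NormedSpace.exp A) := by
  simpa only [one_pow, one_mul] using reTrace_sq_mul_exp_nonneg hA Matrix.isHermitian_one

theorem le_reTrace_cfc_of_mem_spectrum (hA : A.IsHermitian) {φ : ℝ → ℝ} (hφ : ∀ x, 0 ≤ φ x)
    {x : ℝ} (hx : x ∈ spectrum ℝ A) : φ x ≤ reTrace (cfc φ A) := by
  rw [hA.spectrum_real_eq_range_eigenvalues] at hx
  obtain ⟨i, rfl⟩ := hx
  rw [reTrace_cfc hA]
  exact Finset.single_le_sum (f := fun i => φ (hA.eigenvalues i)) (fun j _ => hφ _)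
    (Finset.mem_univ i)

theorem sq_norm_le_reTrace_sq (hA : A.IsHermitian) : ‖A‖ ^ 2 ≤ reTrace (A ^ 2) := by
  rcases isEmpty_or_nonempty m with _ | _
  · simp [Subsingleton.elim A 0]
  rw [← cfc_pow_id (R := ℝ) A 2 hA.isSelfAdjoint]
  rcases CStarAlgebra.norm_or_neg_norm_mem_spectrum hA.isSelfAdjoint with h | h
  · exact le_reTrace_cfc_of_mem_spectrum hA sq_nonneg h
  · rw [← neg_sq ‖A‖]
    exact le_reTrace_cfc_of_mem_spectrum hA sq_nonneg h

end MatrixAnalysis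

section ExtremeEigenvalues

variable {d : ℕ} {A : Matrix (Fin d) (Fin d) ℂ}

theorem lambdaMin_eq_neg_lambdaMax_neg (A : Matrix (Fin d) (Fin d) ℂ) :
    lambdaMin A = -lambdaMax (-A) := by
  rw [lambdaMin, lambdaMax, ← spectrum.neg_eq, Real.sInf_def]

theorem le_lambdaMax {x : ℝ} (hx : x ∈ spectrum ℝ A) : x ≤ lambdaMax A :=
  le_csSup Matrix.finite_real_spectrum.bddAbove hx

variable [NeZero d]

theorem lambdaMax_mem_spectrum (hA : A.IsHermitian) : lambdaMax A ∈ spectrum ℝ A := by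
  have h : (spectrum ℝ A).Nonempty :=
    ContinuousFunctionalCalculus.spectrum_nonempty A hA.isSelfAdjoint
  exact h.csSup_mem Matrix.finite_real_spectrum

theorem abs_lambdaMax_le_norm (hA : A.IsHermitian) : |lambdaMax A| ≤ ‖A‖ :=
  spectrum.norm_le_norm_of_mem (lambdaMax_mem_spectrum hA)

theorem lambdaMax_smul (hA : A.IsHermitian) {θ : ℝ} (hθ : 0 ≤ θ) :
    lambdaMax (θ • A) = θ * lambdaMax A := by
  rw [lambdaMax, spectrum.smul_eq_smul θ A ⟨_, lambdaMax_mem_spectrum hA⟩,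
    Real.sSup_smul_of_nonneg hθ, smul_eq_mul, lambdaMax]

theorem exp_mul_lambdaMax_le_reTrace_exp (hA : A.IsHermitian) {θ : ℝ} (hθ : 0 ≤ θ) :
    Real.exp (θ * lambdaMax A) ≤ reTrace (NormedSpace.exp (θ • A)) := by
  have hθA : (θ • A).IsHermitian := hA.smul (.all θ)
  rw [← lambdaMax_smul hA hθ, exp_eq_cfc hθA]
  exact le_reTrace_cfc_of_mem_spectrum hθA (fun x => (Real.exp_pos x).le)
    (lambdaMax_mem_spectrum hθA)

open scoped MatrixOrder in
theorem lambdaMax_eq_norm_sub (hA : A.IsHermitian) :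
    lambdaMax A = ‖algebraMap ℝ _ ‖A‖ + A‖ - ‖A‖ := by
  have hB : 0 ≤ algebraMap ℝ _ ‖A‖ + A :=
    neg_le_iff_add_nonneg'.1 hA.isSelfAdjoint.neg_algebraMap_norm_le_self
  have mem_iff (x : ℝ) : ‖A‖ + x ∈ spectrum ℝ (algebraMap ℝ _ ‖A‖ + A) ↔ x ∈ spectrum ℝ A := by
    rw [add_comm ‖A‖, spectrum.add_mem_add_iff]
  refine le_antisymm ?_ (le_lambdaMax ((mem_iff _).1 ?_))
  · rw [le_sub_iff_add_le']
    exact (le_abs_self _).trans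
      (spectrum.norm_le_norm_of_mem ((mem_iff _).2 (lambdaMax_mem_spectrum hA)))
  · rw [add_sub_cancel]
    exact CStarAlgebra.norm_mem_spectrum_of_nonneg hB

theorem lambdaMax_eq_reTrace [Subsingleton (Fin d)] (hA : A.IsHermitian) :
    lambdaMax A = reTrace A := by
  obtain ⟨i, hi⟩ : lambdaMax A ∈ Set.range hA.eigenvalues :=
    hA.spectrum_real_eq_range_eigenvalues ▸ lambdaMax_mem_spectrum hA
  rw [← hi, reTrace_apply, hA.trace_eq_sum_eigenvalues, Fintype.sum_subsingleton _ i]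
  rfl

theorem aestronglyMeasurable_lambdaMax {α : Type*} [MeasurableSpace α] {ν : Measure α}
    {g : α → Matrix (Fin d) (Fin d) ℂ} (hg : AEStronglyMeasurable g ν)
    (hherm : ∀ x, (g x).IsHermitian) : AEStronglyMeasurable (fun x => lambdaMax (g x)) ν := by
  simp only [lambdaMax_eq_norm_sub (hherm _)]
  have h : Continuous fun A : Matrix (Fin d) (Fin d) ℂ => ‖algebraMap ℝ _ ‖A‖ + A‖ - ‖A‖ := by
    simp only [Algebra.algebraMap_eq_smul_one]
    fun_prop
  exact h.comp_aestronglyMeasurable hg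

end ExtremeEigenvalues

section Resampling

variable {ι : Type*} [DecidableEq ι] {Ω : ι → Type*}

/-- The first of two samples, with the coordinates in `S` replaced by those of the second. -/
def resample (S : Finset ι) (p : (∀ i, Ω i) × (∀ i, Ω i)) : ∀ i, Ω i :=
  S.piecewise p.2 p.1

theorem resample_empty (p : (∀ i, Ω i) × (∀ i, Ω i)) : resample ∅ p = p.1 :=
  Finset.piecewise_empty _ _

theorem resample_univ [Fintype ι] (p : (∀ i, Ω i) × (∀ i, Ω i)) : resample Finset.univ p = p.2 :=
  Finset.piecewise_univ _ _

theorem resample_insert (S : Finset ι) (i : ι) (p : (∀ i, Ω i) × (∀ i, Ω i)) :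
    resample (insert i S) p = Function.update (resample S p) i (p.2 i) :=
  Finset.piecewise_insert _ _ _ _

theorem resample_singleton (i : ι) (p : (∀ i, Ω i) × (∀ i, Ω i)) :
    resample {i} p = Function.update p.1 i (p.2 i) :=
  Finset.piecewise_singleton _ _ _

theorem singleton_symmDiff_of_notMem {S : Finset ι} {i : ι} (hi : i ∉ S) :
    {i} ∆ S = insert i S := by
  ext j
  grind [Finset.mem_symmDiff]

theorem resample_update_of_notMem {S : Finset ι} {i : ι} (hi : i ∉ S) (z w : ∀ i, Ω i) (x : Ω i) :
    resample S (z, Function.update w i x) = resample S (z, w) :=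
  S.piecewise_congr
    (fun _ hj => Function.update_of_ne (ne_of_mem_of_not_mem hj hi) _ _) fun _ _ => rfl

variable [∀ i, MeasurableSpace (Ω i)]

theorem measurable_resample (S : Finset ι) : Measurable (resample (Ω := Ω) S) := by
  refine measurable_pi_lambda _ fun i => ?_
  by_cases h : i ∈ S
  · simp only [resample, h, Finset.piecewise_eq_of_mem]
    fun_prop
  · simp only [resample, h, not_false_eq_true, Finset.piecewise_eq_of_notMem]
    fun_prop

/-- The exchange of the coordinates in `S` between two samples. -/
def exchange (S : Finset ι) :
    (∀ i, Ω i) × (∀ i, Ω i) ≃ᵐ (∀ i, Ω i) × (∀ i, Ω i) :=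
  MeasurableEquiv.ofInvolutive (fun p => (resample S p, resample S p.swap))
    (fun p => by
      ext i : 2 <;> by_cases hi : i ∈ S <;> simp [resample, hi])
    ((measurable_resample S).prodMk ((measurable_resample S).comp measurable_swap))

theorem exchange_apply (S : Finset ι) (p : (∀ i, Ω i) × (∀ i, Ω i)) :
    exchange S p = (resample S p, resample S p.swap) := rfl

theorem resample_exchange (S T : Finset ι) (p : (∀ i, Ω i) × (∀ i, Ω i)) :
    resample T (exchange S p) = resample (S ∆ T) p := by
  ext i
  by_cases hS : i ∈ S <;> by_cases hT : i ∈ T <;>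
    simp [exchange_apply, resample, Finset.piecewise, Finset.mem_symmDiff, hS, hT]

variable [Fintype ι] (μ : ∀ i, Measure (Ω i)) [∀ i, IsProbabilityMeasure (μ i)]

theorem measurePreserving_exchange (S : Finset ι) :
    MeasurePreserving (exchange S)
      ((Measure.pi μ).prod (Measure.pi μ)) ((Measure.pi μ).prod (Measure.pi μ)) := by
  refine ⟨(exchange S).measurable, ?_⟩
  have hspan : (Measure.pi μ).FiniteSpanningSetsIn
      (Set.pi Set.univ '' Set.pi Set.univ fun i => {s : Set (Ω i) | MeasurableSet s}) :=
    { set := fun _ => Set.univ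
      set_mem := fun _ => ⟨fun _ => Set.univ, by simp, by simp⟩
      finite := fun _ => measure_lt_top _ _
      spanning := Set.iUnion_const _ }
  refine (Measure.prod_eq_generateFrom generateFrom_pi generateFrom_pi isPiSystem_pi isPiSystem_pi
    hspan hspan ?_).symm
  rintro _ ⟨s, -, rfl⟩ _ ⟨t, -, rfl⟩
  have preimage_eq : exchange S ⁻¹' (Set.univ.pi s ×ˢ Set.univ.pi t) =
      Set.univ.pi (S.piecewise t s) ×ˢ Set.univ.pi (S.piecewise s t) := by
    ext p
    simp only [Set.mem_preimage, Set.mem_prod, Set.mem_pi, Set.mem_univ, true_imp_iff,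
      ← forall_and]
    refine forall_congr' fun i => ?_
    by_cases h : i ∈ S <;> simp [exchange_apply, resample, h, and_comm]
  rw [(exchange S).map_apply, preimage_eq, Measure.prod_prod]
  simp only [Measure.pi_pi, ← Finset.prod_mul_distrib]
  refine Finset.prod_congr rfl fun i _ => ?_
  by_cases h : i ∈ S <;> simp [h, mul_comm]

theorem measurePreserving_resample (S : Finset ι) :
    MeasurePreserving (resample S) ((Measure.pi μ).prod (Measure.pi μ)) (Measure.pi μ) :=
  measurePreserving_fst.comp (measurePreserving_exchange μ S)

/-- The hypothesis says that `φ x w` does not depend on the coordinate `w i`. -/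
theorem lintegral_apply_self {i : ι} {φ : Ω i → (∀ j, Ω j) → ℝ≥0∞}
    (hφ : ∀ x y w, φ x (Function.update w i y) = φ x w)
    (hm : AEMeasurable (fun w => φ (w i) w) (Measure.pi μ)) :
    ∫⁻ w, φ (w i) w ∂(Measure.pi μ) =
      ∫⁻ w, ∫⁻ w', φ (w' i) w ∂(Measure.pi μ) ∂(Measure.pi μ) := by
  have hmp := measurePreserving_resample μ {i}
  have hm' := hm.comp_quasiMeasurePreserving hmp.quasiMeasurePreserving
  simp only [Function.comp_def, resample_singleton, Function.update_self, hφ] at hm'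
  rw [← hmp.map_eq] at hm
  rw [← hmp.map_eq, lintegral_map' hm hmp.aemeasurable]
  simp only [resample_singleton, Function.update_self, hφ]
  rw [lintegral_prod _ hm', hmp.map_eq]

theorem integral_apply_self {E : Type*} [NormedAddCommGroup E] [NormedSpace ℝ E]
    {i : ι} {φ : Ω i → (∀ j, Ω j) → E} (hφ : ∀ x y w, φ x (Function.update w i y) = φ x w)
    (hint : Integrable (fun w => φ (w i) w) (Measure.pi μ)) :
    ∫ w, φ (w i) w ∂(Measure.pi μ) =
      ∫ w, ∫ w', φ (w' i) w ∂(Measure.pi μ) ∂(Measure.pi μ) := by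
  have hmp := measurePreserving_resample μ {i}
  have hint' := hmp.integrable_comp_of_integrable hint
  simp only [Function.comp_def, resample_singleton, Function.update_self, hφ] at hint'
  have hm : AEStronglyMeasurable (fun w => φ (w i) w)
      (((Measure.pi μ).prod (Measure.pi μ)).map (resample {i})) := by
    rw [hmp.map_eq]
    exact hint.aestronglyMeasurable
  rw [← hmp.map_eq, integral_map hmp.aemeasurable hm]
  simp only [resample_singleton, Function.update_self, hφ]
  rw [integral_prod _ hint', hmp.map_eq]

variable {E : Type*} [NormedAddCommGroup E] {g : (∀ i, Ω i) → E} {C : ℝ≥0∞}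

theorem ae_lintegral_enorm_sub_resample_le (hg : AEStronglyMeasurable g (Measure.pi μ))
    (h : ∀ᵐ z ∂(Measure.pi μ), ∀ i,
      ∫⁻ w, ‖g z - g (Function.update z i (w i))‖ₑ ∂(Measure.pi μ) ≤ C) (S : Finset ι) :
    ∀ᵐ z ∂(Measure.pi μ), ∫⁻ w, ‖g z - g (resample S (z, w))‖ₑ ∂(Measure.pi μ) ≤ S.card * C := by
  have hres (T : Finset ι) :=
    hg.comp_quasiMeasurePreserving (measurePreserving_resample μ T).quasiMeasurePreserving
  induction S using Finset.induction_on with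
  | empty => simp [resample_empty]
  | insert i S hi ih =>
    have hS := Measure.ae_ae_of_ae_prod
      ((measurePreserving_resample μ S).quasiMeasurePreserving.ae h)
    filter_upwards [ih, hS, (hres S).prodMk_left, (hres (insert i S)).prodMk_left]
      with z ih hS hmS hmS'
    simp only [Function.comp_apply] at hmS hmS'
    have hstep : ∫⁻ w, ‖g (resample S (z, w)) - g (resample (insert i S) (z, w))‖ₑ
        ∂(Measure.pi μ) ≤ C := by
      have hm := (hmS.sub hmS').enorm
      simp only [Pi.sub_apply, resample_insert] at hm ⊢
      rw [lintegral_apply_self μ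
        (φ := fun x w => ‖g (resample S (z, w)) - g (Function.update (resample S (z, w)) i x)‖ₑ)
        (fun x y w => by rw [resample_update_of_notMem hi]) hm]
      exact (lintegral_mono_ae (hS.mono fun w hw => hw i)).trans_eq (by simp)
    calc ∫⁻ w, ‖g z - g (resample (insert i S) (z, w))‖ₑ ∂(Measure.pi μ)
        ≤ ∫⁻ w, (‖g z - g (resample S (z, w))‖ₑ +
            ‖g (resample S (z, w)) - g (resample (insert i S) (z, w))‖ₑ) ∂(Measure.pi μ) := by
          refine lintegral_mono fun w => ?_
          rw [← sub_add_sub_cancel (g z) (g (resample S (z, w)))]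
          exact enorm_add_le _ _
      _ = _ + _ := lintegral_add_left' (aestronglyMeasurable_const.sub hmS).enorm _
      _ ≤ S.card * C + C := add_le_add ih hstep
      _ = (insert i S).card * C := by
          rw [Finset.card_insert_of_notMem hi, Nat.cast_add_one, add_one_mul]

theorem ae_enorm_le_lintegral_enorm_add (hg : AEStronglyMeasurable g (Measure.pi μ))
    (h : ∀ᵐ z ∂(Measure.pi μ), ∀ i,
      ∫⁻ w, ‖g z - g (Function.update z i (w i))‖ₑ ∂(Measure.pi μ) ≤ C) :
    ∀ᵐ z ∂(Measure.pi μ),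
      ‖g z‖ₑ ≤ ∫⁻ w, ‖g w‖ₑ ∂(Measure.pi μ) + Fintype.card ι * C := by
  filter_upwards [ae_lintegral_enorm_sub_resample_le μ hg h Finset.univ] with z hz
  simp only [resample_univ, Finset.card_univ] at hz
  calc ‖g z‖ₑ = ∫⁻ _ : (∀ i, Ω i), ‖g z‖ₑ ∂(Measure.pi μ) := by simp
    _ ≤ ∫⁻ w, (‖g w‖ₑ + ‖g z - g w‖ₑ) ∂(Measure.pi μ) := by
        refine lintegral_mono fun w => ?_
        simpa using enorm_add_le (g w) (g z - g w)
    _ = _ + _ := lintegral_add_left' hg.enorm _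
    _ ≤ _ := by gcongr

end Resampling

section BernoulliMean

variable {ι : Type*} [Fintype ι] [DecidableEq ι]

/-- The probability that the random subset of `ι` which contains each point independently with
probability `p` is equal to `S`. -/
def bernoulliWeight (p : ℝ) (S : Finset ι) : ℝ :=
  p ^ S.card * (1 - p) ^ Sᶜ.card

/-- The mean of `F` at the random subset of `ι` which contains each point independently with
probability `p`. -/
def bernoulliMean (p : ℝ) (F : Finset ι → ℝ) : ℝ :=
  ∑ S, bernoulliWeight p S * F S

theorem bernoulliWeight_nonneg {p : ℝ} (hp₀ : 0 ≤ p) (hp₁ : p ≤ 1) (S : Finset ι) :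
    0 ≤ bernoulliWeight p S :=
  mul_nonneg (pow_nonneg hp₀ _) (pow_nonneg (sub_nonneg.2 hp₁) _)

theorem sum_bernoulliWeight (p : ℝ) : ∑ S : Finset ι, bernoulliWeight p S = 1 := by
  simp only [bernoulliWeight, Finset.card_compl, Fintype.sum_pow_mul_eq_add_pow,
    add_sub_cancel, one_pow]

theorem bernoulliMean_mono {p : ℝ} (hp₀ : 0 ≤ p) (hp₁ : p ≤ 1) {F G : Finset ι → ℝ}
    (h : ∀ S, F S ≤ G S) : bernoulliMean p F ≤ bernoulliMean p G :=
  Finset.sum_le_sum fun S _ => mul_le_mul_of_nonneg_left (h S) (bernoulliWeight_nonneg hp₀ hp₁ S)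

theorem bernoulliMean_const (p c : ℝ) : bernoulliMean p (fun _ : Finset ι => c) = c := by
  rw [bernoulliMean, ← Finset.sum_mul, sum_bernoulliWeight, one_mul]

theorem bernoulliMean_zero (F : Finset ι → ℝ) : bernoulliMean 0 F = F ∅ := by
  rw [bernoulliMean, Finset.sum_eq_single ∅ (fun S _ hS => by simp [bernoulliWeight, hS]) (by simp)]
  simp [bernoulliWeight]

theorem bernoulliMean_one (F : Finset ι → ℝ) : bernoulliMean 1 F = F Finset.univ := by
  rw [bernoulliMean, Finset.sum_eq_single Finset.univ
    (fun S _ hS => by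
      simp [bernoulliWeight, Finset.card_eq_zero, Finset.compl_eq_empty_iff, hS]) (by simp)]
  simp [bernoulliWeight]

theorem card_compl_erase {S : Finset ι} {i : ι} (hi : i ∈ S) :
    (S.erase i)ᶜ.card = Sᶜ.card + 1 := by
  rw [Finset.compl_erase, Finset.card_insert_of_notMem (by simpa using hi)]

theorem mul_bernoulliWeight_erase (p : ℝ) {S : Finset ι} {i : ι} (hi : i ∈ S) :
    p * bernoulliWeight p (S.erase i) = (1 - p) * bernoulliWeight p S := by
  rw [bernoulliWeight, bernoulliWeight, card_compl_erase hi, ← Finset.card_erase_add_one hi]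
  ring

theorem sum_sum_erase_eq_sum_sum_compl {M : Type*} [AddCommMonoid M] (G : Finset ι → ι → M) :
    ∑ S, ∑ i ∈ S, G (S.erase i) i = ∑ S, ∑ i ∈ Sᶜ, G S i := by
  rw [Finset.sum_sigma', Finset.sum_sigma']
  refine Finset.sum_nbij' (fun x => ⟨x.1.erase x.2, x.2⟩) (fun x => ⟨insert x.2 x.1, x.2⟩)
    ?_ ?_ ?_ ?_ ?_ <;> simp +contextual

theorem bernoulliMean_sum_compl (p : ℝ) (c : ι → ℝ) :
    bernoulliMean p (fun S => ∑ i ∈ Sᶜ, c i) = (1 - p) * ∑ i, c i := by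
  have hadd : bernoulliMean p (fun S => ∑ i ∈ S, c i) + bernoulliMean p (fun S => ∑ i ∈ Sᶜ, c i)
      = ∑ i, c i := by
    simp only [bernoulliMean, ← Finset.sum_add_distrib, ← mul_add, Finset.sum_add_sum_compl,
      ← Finset.sum_mul, sum_bernoulliWeight, one_mul]
  have hmul : (1 - p) * bernoulliMean p (fun S => ∑ i ∈ S, c i) =
      p * bernoulliMean p (fun S => ∑ i ∈ Sᶜ, c i) := by
    simp only [bernoulliMean, Finset.mul_sum, ← mul_assoc]
    rw [← sum_sum_erase_eq_sum_sum_compl fun S i => p * bernoulliWeight p S * c i]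
    exact Finset.sum_congr rfl fun S _ => Finset.sum_congr rfl fun i hi => by
      rw [mul_bernoulliWeight_erase p hi]
  linear_combination (1 - p) * hadd - hmul

theorem hasDerivAt_bernoulliWeight {p : ℝ} (hp : p ≠ 1) (S : Finset ι) :
    HasDerivAt (fun p => bernoulliWeight p S)
      ((1 - p)⁻¹ * (∑ i ∈ S, bernoulliWeight p (S.erase i) - Sᶜ.card * bernoulliWeight p S)) p := by
  have hp' : 1 - p ≠ 0 := sub_ne_zero.2 hp.symm
  refine ((hasDerivAt_pow S.card p).mul
    (((hasDerivAt_id' p).const_sub 1).fun_pow Sᶜ.card)).congr_deriv ?_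
  have herase : ∑ i ∈ S, bernoulliWeight p (S.erase i) =
      S.card * (p ^ (S.card - 1) * (1 - p) ^ (Sᶜ.card + 1)) := by
    rw [← nsmul_eq_mul, ← Finset.sum_const]
    exact Finset.sum_congr rfl fun i hi => by
      rw [bernoulliWeight, card_compl_erase hi, Finset.card_erase_of_mem hi]
  have hcompl : (Sᶜ.card : ℝ) * (1 - p) ^ Sᶜ.card =
      Sᶜ.card * ((1 - p) * (1 - p) ^ (Sᶜ.card - 1)) := by
    rcases Nat.eq_zero_or_pos Sᶜ.card with h | h
    · simp [h]
    · rw [mul_pow_sub_one h.ne']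
  rw [herase, bernoulliWeight, eq_inv_mul_iff_mul_eq₀ hp']
  linear_combination p ^ S.card * hcompl

theorem hasDerivAt_bernoulliMean {p : ℝ} (hp : p ≠ 1) (F : Finset ι → ℝ) :
    HasDerivAt (fun p => bernoulliMean p F)
      ((1 - p)⁻¹ * bernoulliMean p fun S => ∑ i ∈ Sᶜ, (F (insert i S) - F S)) p := by
  refine (HasDerivAt.fun_sum fun S _ =>
    (hasDerivAt_bernoulliWeight hp S).mul_const (F S)).congr_deriv ?_
  have hinsert : ∑ S : Finset ι, ∑ i ∈ S, bernoulliWeight p (S.erase i) * F S =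
      ∑ S, ∑ i ∈ Sᶜ, bernoulliWeight p S * F (insert i S) := by
    rw [← sum_sum_erase_eq_sum_sum_compl fun S i => bernoulliWeight p S * F (insert i S)]
    exact Finset.sum_congr rfl fun S _ => Finset.sum_congr rfl fun i hi => by
      rw [Finset.insert_erase hi]
  simp only [mul_assoc, ← Finset.mul_sum, sub_mul, Finset.sum_sub_distrib, bernoulliMean, mul_sub,
    Finset.sum_mul, hinsert, Finset.sum_const, nsmul_eq_mul]
  simp only [Finset.mul_sum, mul_left_comm]

theorem continuous_bernoulliMean (F : Finset ι → ℝ) : Continuous fun p => bernoulliMean p F := by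
  unfold bernoulliMean bernoulliWeight
  fun_prop

theorem neg_bernoulliMean_le {a : Finset ι → ℝ} {b : Finset ι → ι → ℝ} {c : ι → ℝ} {K s : ℝ}
    (h : ∀ S, ∀ i ∈ Sᶜ, a S - a (insert i S) ≤ s * b S i + s⁻¹ * c i)
    (hb : ∀ S, ∑ i ∈ Sᶜ, b S i ≤ K) (hc : ∑ i, c i ≤ K) (hs₀ : 0 < s) (hs₁ : s ≤ 1) :
    -bernoulliMean (1 - s ^ 2) (fun S => ∑ i ∈ Sᶜ, (a (insert i S) - a S)) ≤ 2 * K * s := by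
  calc -bernoulliMean (1 - s ^ 2) (fun S => ∑ i ∈ Sᶜ, (a (insert i S) - a S))
      = bernoulliMean (1 - s ^ 2) (fun S => ∑ i ∈ Sᶜ, (a S - a (insert i S))) := by
        simp only [bernoulliMean, ← Finset.sum_neg_distrib, ← mul_neg, neg_sub]
    _ ≤ bernoulliMean (1 - s ^ 2) (fun S => s * K + s⁻¹ * ∑ i ∈ Sᶜ, c i) := by
        refine bernoulliMean_mono (by nlinarith) (by nlinarith) fun S => ?_
        calc ∑ i ∈ Sᶜ, (a S - a (insert i S)) ≤ ∑ i ∈ Sᶜ, (s * b S i + s⁻¹ * c i) :=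
              Finset.sum_le_sum (h S)
          _ = s * ∑ i ∈ Sᶜ, b S i + s⁻¹ * ∑ i ∈ Sᶜ, c i := by
              rw [Finset.sum_add_distrib, Finset.mul_sum, Finset.mul_sum]
          _ ≤ _ := by gcongr; exact hb S
    _ = s * K + s⁻¹ * (s ^ 2 * ∑ i, c i) := by
        have hadd : bernoulliMean (1 - s ^ 2) (fun S => s * K + s⁻¹ * ∑ i ∈ Sᶜ, c i) =
            bernoulliMean (1 - s ^ 2) (fun _ : Finset ι => s * K) +
              s⁻¹ * bernoulliMean (1 - s ^ 2) (fun S => ∑ i ∈ Sᶜ, c i) := by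
          simp only [bernoulliMean, mul_add, Finset.sum_add_distrib, Finset.mul_sum, mul_left_comm]
        rw [hadd, bernoulliMean_const, bernoulliMean_sum_compl, sub_sub_cancel]
    _ ≤ s * K + s⁻¹ * (s ^ 2 * K) := by gcongr
    _ = 2 * K * s := by field_simp; ring

/-- The bound is integrated along the random subsets of density `p` rising from `0` to `1`; the
choice `s = √(1 - p)` balances the two error terms. -/
theorem sub_univ_le_four_mul {a : Finset ι → ℝ} {b : Finset ι → ι → ℝ} {c : ι → ℝ} {K : ℝ}
    (h : ∀ s > 0, ∀ S, ∀ i ∈ Sᶜ, a S - a (insert i S) ≤ s * b S i + s⁻¹ * c i)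
    (hb : ∀ S, ∑ i ∈ Sᶜ, b S i ≤ K) (hc : ∑ i, c i ≤ K) : a ∅ - a Finset.univ ≤ 4 * K := by
  have hderiv {p : ℝ} (hp : p < 1) : HasDerivAt (fun p => bernoulliMean p a - 4 * K * √(1 - p))
      ((1 - p)⁻¹ * bernoulliMean p (fun S => ∑ i ∈ Sᶜ, (a (insert i S) - a S)) +
        2 * K * (√(1 - p))⁻¹) p := by
    refine ((hasDerivAt_bernoulliMean hp.ne a).sub
      ((((hasDerivAt_id' p).const_sub 1).sqrt (sub_pos.2 hp).ne').const_mul (4 * K))).congr_deriv ?_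
    ring
  have hnonneg {p : ℝ} (hp₀ : 0 < p) (hp₁ : p < 1) :
      0 ≤ (1 - p)⁻¹ * bernoulliMean p (fun S => ∑ i ∈ Sᶜ, (a (insert i S) - a S)) +
        2 * K * (√(1 - p))⁻¹ := by
    have hpos : 0 < √(1 - p) := Real.sqrt_pos.2 (sub_pos.2 hp₁)
    have hsq : √(1 - p) ^ 2 = 1 - p := Real.sq_sqrt (sub_pos.2 hp₁).le
    have hmean := neg_bernoulliMean_le (h _ hpos) hb hc hpos (Real.sqrt_le_one.2 (by linarith))
    rw [hsq, sub_sub_cancel] at hmean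
    have hinv : 2 * K * (√(1 - p))⁻¹ = (1 - p)⁻¹ * (2 * K * √(1 - p)) := by
      rw [← hsq, Real.sqrt_sq hpos.le]
      field_simp
    rw [hinv, ← mul_add]
    exact mul_nonneg (inv_nonneg.2 (sub_pos.2 hp₁).le) (by linarith)
  have hmono : MonotoneOn (fun p => bernoulliMean p a - 4 * K * √(1 - p)) (Set.Icc 0 1) := by
    have hcont := continuous_bernoulliMean a
    refine monotoneOn_of_deriv_nonneg (convex_Icc 0 1) (by fun_prop) ?_ ?_ <;>
      rw [interior_Icc]
    · exact fun p hp => (hderiv hp.2).differentiableAt.differentiableWithinAt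
    · exact fun p hp => (hderiv hp.2).deriv ▸ hnonneg hp.1 hp.2
  have := hmono (Set.left_mem_Icc.2 zero_le_one) (Set.right_mem_Icc.2 zero_le_one) zero_le_one
  simp only [bernoulliMean_zero, bernoulliMean_one, sub_zero, sub_self, Real.sqrt_one,
    Real.sqrt_zero] at this
  linarith

end BernoulliMean

section ExponentialCovariance

theorem integrable_comp_of_ae_norm_le {α E F : Type*} [MeasurableSpace α] {ν : Measure α}
    [IsFiniteMeasure ν] [NormedAddCommGroup E] [ProperSpace E] [NormedAddCommGroup F]
    {h : α → E} (hm : AEStronglyMeasurable h ν) {R : ℝ} (hR : ∀ᵐ x ∂ν, ‖h x‖ ≤ R)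
    {Φ : E → F} (hΦ : Continuous Φ) : Integrable (fun x => Φ (h x)) ν := by
  obtain ⟨B, hB⟩ := (isCompact_closedBall (0 : E) R).exists_bound_of_continuousOn hΦ.continuousOn
  exact Integrable.of_bound (hΦ.comp_aestronglyMeasurable hm) B
    (hR.mono fun x hx => hB _ (mem_closedBall_zero_iff.2 hx))

theorem reTrace_integral_mul {α m : Type*} [MeasurableSpace α] {ν : Measure α} [Fintype m]
    [DecidableEq m] {X : α → Matrix m m ℂ} (hX : Integrable X ν) (M : Matrix m m ℂ) :
    reTrace ((∫ x, X x ∂ν) * M) = ∫ x, reTrace (X x * M) ∂ν := by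
  rw [← integral_mul_const_of_integrable hX, reTrace.integral_comp_comm (hX.mul_const M)]

variable {ι m : Type*} [Fintype ι] [DecidableEq ι] {Ω : ι → Type*} [∀ i, MeasurableSpace (Ω i)]
  (μ : ∀ i, Measure (Ω i))

theorem integrable_comp_resample [∀ i, IsProbabilityMeasure (μ i)] {E F : Type*}
    [NormedAddCommGroup E] [ProperSpace E] [NormedAddCommGroup F] {g : (∀ i, Ω i) → E} {R : ℝ}
    (hg : AEStronglyMeasurable g (Measure.pi μ)) (hR : ∀ᵐ z ∂(Measure.pi μ), ‖g z‖ ≤ R)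
    {Φ : E × E × E → F} (hΦ : Continuous Φ) (S T U : Finset ι) :
    Integrable (fun p => Φ (g (resample S p), g (resample T p), g (resample U p)))
      ((Measure.pi μ).prod (Measure.pi μ)) := by
  have hmp (S : Finset ι) := (measurePreserving_resample μ S).quasiMeasurePreserving
  have hm (S : Finset ι) := hg.comp_quasiMeasurePreserving (hmp S)
  refine integrable_comp_of_ae_norm_le (R := R) ((hm S).prodMk ((hm T).prodMk (hm U))) ?_ hΦ
  filter_upwards [(hmp S).ae hR, (hmp T).ae hR, (hmp U).ae hR] with p hS hT hU
  exact norm_prod_le_iff.2 ⟨hS, norm_prod_le_iff.2 ⟨hT, hU⟩⟩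

variable [Fintype m] [DecidableEq m] (f : (∀ i, Ω i) → Matrix m m ℂ)

/-- The mean of `tr ((f_S - f_{S ∪ {i}})² exp f_T)`, where `f_S` is `f` evaluated after resampling
the coordinates in `S`. -/
def resampledEnergy (S : Finset ι) (i : ι) (T : Finset ι) : ℝ :=
  ∫ p, reTrace ((f (resample S p) - f (resample (insert i S) p)) ^ 2 *
    NormedSpace.exp (f (resample T p))) ∂((Measure.pi μ).prod (Measure.pi μ))

variable [∀ i, IsProbabilityMeasure (μ i)]

theorem integral_exchange {E : Type*} [NormedAddCommGroup E] [NormedSpace ℝ E] (S : Finset ι)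
    (F : (∀ i, Ω i) × (∀ i, Ω i) → E) :
    ∫ p, F (exchange S p) ∂((Measure.pi μ).prod (Measure.pi μ)) =
      ∫ p, F p ∂((Measure.pi μ).prod (Measure.pi μ)) :=
  (measurePreserving_exchange μ S).integral_comp' F

theorem integral_resample {E : Type*} [NormedAddCommGroup E] [NormedSpace ℝ E] (S : Finset ι)
    {F : (∀ i, Ω i) → E} (hF : AEStronglyMeasurable F (Measure.pi μ)) :
    ∫ p, F (resample S p) ∂((Measure.pi μ).prod (Measure.pi μ)) = ∫ z, F z ∂(Measure.pi μ) := by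
  have hmp := measurePreserving_resample μ S
  rw [← hmp.map_eq] at hF
  rw [← integral_map hmp.aemeasurable hF, hmp.map_eq]

variable {S : Finset ι} {i : ι}

theorem resampledEnergy_singleton (hi : i ∉ S) :
    resampledEnergy μ f S i {i} = resampledEnergy μ f S i ∅ := by
  have hsymm (M N : Matrix m m ℂ) : (M - N) ^ 2 = (N - M) ^ 2 := by rw [← neg_sub, neg_sq]
  rw [resampledEnergy, ← integral_exchange μ {i}, resampledEnergy]
  simp only [resample_exchange, ← singleton_symmDiff_of_notMem hi, symmDiff_symmDiff_cancel_left,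
    symmDiff_self, Finset.bot_eq_empty]
  simp only [hsymm]

theorem resampledEnergy_empty_comm (hi : i ∉ S) :
    resampledEnergy μ f S i ∅ = resampledEnergy μ f ∅ i S := by
  rw [resampledEnergy, ← integral_exchange μ S, resampledEnergy]
  have hempty : S ∆ ∅ = S := symmDiff_bot S
  simp only [resample_exchange, ← singleton_symmDiff_of_notMem hi, symmDiff_comm {i} S, hempty,
    symmDiff_symmDiff_cancel_left, symmDiff_self, Finset.bot_eq_empty, insert_empty_eq]

variable {f} {R v : ℝ}

theorem integrable_reTrace_sub_sq_mul_exp (hf : AEStronglyMeasurable f (Measure.pi μ))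
    (hR : ∀ᵐ z ∂(Measure.pi μ), ‖f z‖ ≤ R) (S T U : Finset ι) :
    Integrable (fun p => reTrace ((f (resample S p) - f (resample T p)) ^ 2 *
      NormedSpace.exp (f (resample U p)))) ((Measure.pi μ).prod (Measure.pi μ)) :=
  integrable_comp_resample μ hf hR
    (Φ := fun x => reTrace ((x.1 - x.2.1) ^ 2 * NormedSpace.exp x.2.2)) (by fun_prop) S T U

theorem integrable_reTrace_sub_mul_exp (hf : AEStronglyMeasurable f (Measure.pi μ))
    (hR : ∀ᵐ z ∂(Measure.pi μ), ‖f z‖ ≤ R) (S T U : Finset ι) :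
    Integrable (fun p => reTrace ((f (resample S p) - f (resample T p)) *
      NormedSpace.exp (f (resample U p)))) ((Measure.pi μ).prod (Measure.pi μ)) :=
  integrable_comp_resample μ hf hR
    (Φ := fun x => reTrace ((x.1 - x.2.1) * NormedSpace.exp x.2.2)) (by fun_prop) S T U

theorem integral_reTrace_sub_mul_exp_sub_le (hf : AEStronglyMeasurable f (Measure.pi μ))
    (hR : ∀ᵐ z ∂(Measure.pi μ), ‖f z‖ ≤ R) (hherm : ∀ z, (f z).IsHermitian) (hi : i ∉ S)
    {s : ℝ} (hs : 0 < s) :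
    ∫ p, reTrace ((f (resample S p) - f (resample (insert i S) p)) *
        NormedSpace.exp (f (resample ∅ p))) ∂((Measure.pi μ).prod (Measure.pi μ)) -
      ∫ p, reTrace ((f (resample S p) - f (resample (insert i S) p)) *
        NormedSpace.exp (f (resample {i} p))) ∂((Measure.pi μ).prod (Measure.pi μ)) ≤
      (s * resampledEnergy μ f S i ∅ + s⁻¹ * resampledEnergy μ f ∅ i ∅) / 2 := by
  have hlin (T) := integrable_reTrace_sub_mul_exp μ hf hR S (insert i S) T
  have hsq (S T) := integrable_reTrace_sub_sq_mul_exp μ hf hR S (insert i S) T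
  have hsqS := ((hsq S ∅).add (hsq S {i})).const_mul s
  have hsq₀ := ((hsq ∅ ∅).add (hsq ∅ {i})).const_mul s⁻¹
  calc _ = ∫ p, _ ∂((Measure.pi μ).prod (Measure.pi μ)) :=
        (integral_sub (hlin ∅) (hlin {i})).symm
    _ ≤ ∫ p, _ ∂((Measure.pi μ).prod (Measure.pi μ)) :=
        integral_mono ((hlin ∅).sub (hlin {i})) ((hsqS.add hsq₀).div_const 4) fun p => by
          simpa only [Pi.add_apply, insert_empty_eq, ← map_sub, ← mul_sub] using
            reTrace_mul_exp_sub_exp_le (hherm (resample ∅ p)) (hherm (resample {i} p))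
              ((hherm (resample S p)).sub (hherm (resample (insert i S) p))) hs
    _ = (s * (resampledEnergy μ f S i ∅ + resampledEnergy μ f S i {i}) +
          s⁻¹ * (resampledEnergy μ f ∅ i ∅ + resampledEnergy μ f ∅ i {i})) / 4 := by
        rw [integral_div, integral_add' hsqS hsq₀, integral_const_mul, integral_const_mul,
          integral_add' (hsq S ∅) (hsq S {i}), integral_add' (hsq ∅ ∅) (hsq ∅ {i})]
        rfl
    _ = _ := by
        rw [resampledEnergy_singleton μ f hi, resampledEnergy_singleton μ f (Finset.notMem_empty i)]
        ring

/-- Exchanging the `i`-th coordinates changes the sign of `f_S - f_{S ∪ {i}}`, so the left side is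
half the mean of `tr ((f_S - f_{S ∪ {i}}) (exp f_∅ - exp f_{i}))`. -/
theorem integral_reTrace_sub_mul_exp_le (hf : AEStronglyMeasurable f (Measure.pi μ))
    (hR : ∀ᵐ z ∂(Measure.pi μ), ‖f z‖ ≤ R) (hherm : ∀ z, (f z).IsHermitian) (hi : i ∉ S)
    {s : ℝ} (hs : 0 < s) :
    ∫ p, reTrace ((f (resample S p) - f (resample (insert i S) p)) *
        NormedSpace.exp (f (resample ∅ p))) ∂((Measure.pi μ).prod (Measure.pi μ)) ≤
      (s * resampledEnergy μ f S i ∅ + s⁻¹ * resampledEnergy μ f ∅ i ∅) / 4 := by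
  have hanti : ∫ p, reTrace ((f (resample S p) - f (resample (insert i S) p)) *
        NormedSpace.exp (f (resample {i} p))) ∂((Measure.pi μ).prod (Measure.pi μ)) =
      -∫ p, reTrace ((f (resample S p) - f (resample (insert i S) p)) *
        NormedSpace.exp (f (resample ∅ p))) ∂((Measure.pi μ).prod (Measure.pi μ)) := by
    rw [← integral_exchange μ {i}, ← integral_neg]
    simp only [resample_exchange, ← singleton_symmDiff_of_notMem hi, symmDiff_self,
      symmDiff_symmDiff_cancel_left, ← map_neg, ← neg_mul, neg_sub, Finset.bot_eq_empty]
  have hle := integral_reTrace_sub_mul_exp_sub_le μ hf hR hherm hi hs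
  rw [hanti] at hle
  linarith

theorem integral_reTrace_mul_nonneg {α : Type*} [MeasurableSpace α] {ν : Measure α}
    {X : α → Matrix m m ℂ} (hX : ∀ x, (X x).IsHermitian) {A : Matrix m m ℂ} (hA : A.IsHermitian) :
    0 ≤ reTrace ((∫ x, X x ^ 2 ∂ν) * NormedSpace.exp A) := by
  by_cases hint : Integrable (fun x => X x ^ 2) ν
  · rw [reTrace_integral_mul hint]
    exact integral_nonneg fun x => reTrace_sq_mul_exp_nonneg hA (hX x)
  · rw [integral_undef hint, zero_mul, map_zero]

/-- For a given `z`, the increment depends on `w i` only and the exponential does not depend on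
`w i`, so that the squared increment may be replaced by its mean. -/
theorem ae_integral_reTrace_sq_mul_exp_eq (hf : AEStronglyMeasurable f (Measure.pi μ))
    (hR : ∀ᵐ z ∂(Measure.pi μ), ‖f z‖ ≤ R) (hi : i ∉ S) :
    ∀ᵐ z ∂(Measure.pi μ), ∫ w, reTrace ((f (resample ∅ (z, w)) - f (resample {i} (z, w))) ^ 2 *
        NormedSpace.exp (f (resample S (z, w)))) ∂(Measure.pi μ) =
      ∫ w, reTrace ((∫ w', (f z - f (Function.update z i (w' i))) ^ 2 ∂(Measure.pi μ)) *
        NormedSpace.exp (f (resample S (z, w)))) ∂(Measure.pi μ) := by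
  have hsq := integrable_comp_resample μ hf hR (Φ := fun x => (x.1 - x.2.1) ^ 2) (by fun_prop)
    ∅ {i} ∅
  filter_upwards [(integrable_reTrace_sub_sq_mul_exp μ hf hR ∅ {i} S).prod_right_ae,
    hsq.prod_right_ae] with z hint hsq
  simp only [resample_empty, resample_singleton] at hint hsq ⊢
  rw [integral_apply_self μ (φ := fun x w =>
    reTrace ((f z - f (Function.update z i x)) ^ 2 * NormedSpace.exp (f (resample S (z, w)))))
    (fun x y w => by rw [resample_update_of_notMem hi]) hint]
  simp only [reTrace_integral_mul hsq]

theorem ae_sum_integral_reTrace_sq_mul_exp_le (hf : AEStronglyMeasurable f (Measure.pi μ))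
    (hR : ∀ᵐ z ∂(Measure.pi μ), ‖f z‖ ≤ R) (hherm : ∀ z, (f z).IsHermitian)
    (hv : ∀ᵐ z ∂(Measure.pi μ),
      ‖∑ i, ∫ w, (f z - f (Function.update z i (w i))) ^ 2 ∂(Measure.pi μ)‖ ≤ v) (S : Finset ι) :
    ∀ᵐ z ∂(Measure.pi μ), ∑ i ∈ Sᶜ, ∫ w, reTrace (
        (f (resample ∅ (z, w)) - f (resample {i} (z, w))) ^ 2 *
          NormedSpace.exp (f (resample S (z, w)))) ∂(Measure.pi μ) ≤
      v * ∫ w, reTrace (NormedSpace.exp (f (resample S (z, w)))) ∂(Measure.pi μ) := by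
  have hexp := integrable_comp_resample μ hf hR (Φ := fun x => NormedSpace.exp x.1)
    (by fun_prop) S S S
  have heq : ∀ᵐ z ∂(Measure.pi μ), ∀ i : (Sᶜ : Finset ι), _ :=
    ae_all_iff.2 fun i => ae_integral_reTrace_sq_mul_exp_eq μ hf hR (Finset.mem_compl.1 i.2)
  filter_upwards [hv, heq, hexp.prod_right_ae] with z hv heq hexp
  set V : ι → Matrix m m ℂ := fun i =>
    ∫ w, (f z - f (Function.update z i (w i))) ^ 2 ∂(Measure.pi μ)
  set G := fun w => NormedSpace.exp (f (resample S (z, w)))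
  have hint (M : Matrix m m ℂ) : Integrable (fun w => reTrace (M * G w)) (Measure.pi μ) :=
    reTrace.integrable_comp (hexp.const_mul M)
  have hG : Integrable (fun w => reTrace (G w)) (Measure.pi μ) := reTrace.integrable_comp hexp
  calc _ = ∑ i ∈ Sᶜ, ∫ w, reTrace (V i * G w) ∂(Measure.pi μ) :=
        Finset.sum_congr rfl fun i hi => heq ⟨i, hi⟩
    _ ≤ ∑ i, ∫ w, reTrace (V i * G w) ∂(Measure.pi μ) :=
        Finset.sum_le_univ_sum_of_nonneg fun i => integral_nonneg fun w =>
          integral_reTrace_mul_nonneg (fun _ => (hherm _).sub (hherm _)) (hherm _)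
    _ = ∫ w, reTrace ((∑ i, V i) * G w) ∂(Measure.pi μ) := by
        rw [← integral_finsetSum _ fun i _ => hint (V i)]
        simp only [Finset.sum_mul, map_sum]
    _ ≤ ∫ w, v * reTrace (G w) ∂(Measure.pi μ) :=
        integral_mono (hint _) (hG.const_mul v) fun w =>
          (reTrace_mul_exp_le (hherm _) _).trans
            (mul_le_mul_of_nonneg_right hv (reTrace_exp_nonneg (hherm _)))
    _ = v * ∫ w, reTrace (G w) ∂(Measure.pi μ) := integral_const_mul _ _

theorem sum_resampledEnergy_le (hf : AEStronglyMeasurable f (Measure.pi μ))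
    (hR : ∀ᵐ z ∂(Measure.pi μ), ‖f z‖ ≤ R) (hherm : ∀ z, (f z).IsHermitian)
    (hv : ∀ᵐ z ∂(Measure.pi μ),
      ‖∑ i, ∫ w, (f z - f (Function.update z i (w i))) ^ 2 ∂(Measure.pi μ)‖ ≤ v) (S : Finset ι) :
    ∑ i ∈ Sᶜ, resampledEnergy μ f S i ∅ ≤
      v * ∫ z, reTrace (NormedSpace.exp (f z)) ∂(Measure.pi μ) := by
  have hint (i) := integrable_reTrace_sub_sq_mul_exp μ hf hR ∅ {i} S
  have hcont : Continuous fun M : Matrix m m ℂ => reTrace (NormedSpace.exp M) := by fun_prop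
  have hexp := (measurePreserving_resample μ S).integrable_comp_of_integrable
    (integrable_comp_of_ae_norm_le hf hR hcont)
  calc ∑ i ∈ Sᶜ, resampledEnergy μ f S i ∅
      = ∑ i ∈ Sᶜ, ∫ z, ∫ w, reTrace ((f (resample ∅ (z, w)) - f (resample {i} (z, w))) ^ 2 *
          NormedSpace.exp (f (resample S (z, w)))) ∂(Measure.pi μ) ∂(Measure.pi μ) :=
        Finset.sum_congr rfl fun i hi => by
          rw [resampledEnergy_empty_comm μ f (Finset.mem_compl.1 hi), resampledEnergy,
            insert_empty_eq, integral_prod _ (hint i)]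
    _ = ∫ z, ∑ i ∈ Sᶜ, ∫ w, reTrace ((f (resample ∅ (z, w)) - f (resample {i} (z, w))) ^ 2 *
          NormedSpace.exp (f (resample S (z, w)))) ∂(Measure.pi μ) ∂(Measure.pi μ) :=
        (integral_finsetSum _ fun i _ => (hint i).integral_prod_left).symm
    _ ≤ ∫ z, v * ∫ w, reTrace (NormedSpace.exp (f (resample S (z, w)))) ∂(Measure.pi μ)
          ∂(Measure.pi μ) :=
        integral_mono_ae (integrable_finsetSum _ fun i _ => (hint i).integral_prod_left)
          (hexp.integral_prod_left.const_mul v)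
          (ae_sum_integral_reTrace_sq_mul_exp_le μ hf hR hherm hv S)
    _ = v * ∫ z, reTrace (NormedSpace.exp (f z)) ∂(Measure.pi μ) := by
        rw [integral_const_mul, ← integral_resample μ S (hcont.comp_aestronglyMeasurable hf)]
        exact congrArg (v * ·) (integral_prod _ hexp).symm

/-- The quantity `a S` below interpolates between `f z` (for `S = ∅`) and an independent copy of it
(for `S = univ`), whose contribution factors through the mean of `f`. -/
theorem integral_reTrace_sub_mul_exp_le_mul (hf : AEStronglyMeasurable f (Measure.pi μ))
    (hR : ∀ᵐ z ∂(Measure.pi μ), ‖f z‖ ≤ R) (hherm : ∀ z, (f z).IsHermitian)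
    (hv : ∀ᵐ z ∂(Measure.pi μ),
      ‖∑ i, ∫ w, (f z - f (Function.update z i (w i))) ^ 2 ∂(Measure.pi μ)‖ ≤ v) :
    ∫ z, reTrace ((f z - ∫ w, f w ∂(Measure.pi μ)) * NormedSpace.exp (f z)) ∂(Measure.pi μ) ≤
      v * ∫ z, reTrace (NormedSpace.exp (f z)) ∂(Measure.pi μ) := by
  have hK : ∀ S, ∑ i ∈ Sᶜ, resampledEnergy μ f S i ∅ / 4 ≤
      v * (∫ z, reTrace (NormedSpace.exp (f z)) ∂(Measure.pi μ)) / 4 := fun S => by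
    rw [← Finset.sum_div]
    exact div_le_div_of_nonneg_right (sum_resampledEnergy_le μ hf hR hherm hv S) zero_le_four
  set a : Finset ι → ℝ := fun S => ∫ p, reTrace (f (resample S p) * NormedSpace.exp (f p.1))
    ∂((Measure.pi μ).prod (Measure.pi μ))
  have hint (S : Finset ι) := integrable_comp_resample μ hf hR
    (Φ := fun x => reTrace (x.1 * NormedSpace.exp x.2.1)) (by fun_prop) S ∅ S
  simp only [resample_empty] at hint
  have hstep (s : ℝ) (hs : 0 < s) (S : Finset ι) (i) (hi : i ∈ Sᶜ) : a S - a (insert i S) ≤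
      s * (resampledEnergy μ f S i ∅ / 4) + s⁻¹ * (resampledEnergy μ f ∅ i ∅ / 4) := by
    have hle := integral_reTrace_sub_mul_exp_le μ hf hR hherm (Finset.mem_compl.1 hi) hs
    simp only [sub_mul, map_sub, resample_empty] at hle
    rw [integral_sub (hint S) (hint (insert i S))] at hle
    linarith
  have hinterp := sub_univ_le_four_mul hstep hK (by simpa using hK ∅)
  have hcont : Continuous fun M : Matrix m m ℂ => reTrace (M * NormedSpace.exp M) := by fun_prop
  have hself := integrable_comp_of_ae_norm_le hf hR hcont
  have hmul := integrable_comp_of_ae_norm_le hf hR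
    (Φ := fun M => reTrace ((∫ w, f w ∂(Measure.pi μ)) * NormedSpace.exp M)) (by fun_prop)
  have hempty : a ∅ = ∫ z, reTrace (f z * NormedSpace.exp (f z)) ∂(Measure.pi μ) := by
    rw [← integral_resample μ ∅ hself.aestronglyMeasurable]
    simp only [a, resample_empty]
  have huniv : a Finset.univ =
      ∫ z, reTrace ((∫ w, f w ∂(Measure.pi μ)) * NormedSpace.exp (f z)) ∂(Measure.pi μ) := by
    have hf_int : Integrable f (Measure.pi μ) :=
      integrable_comp_of_ae_norm_le hf hR continuous_id
    simp only [a, reTrace_integral_mul hf_int]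
    rw [integral_prod _ (hint _)]
    simp only [resample_univ]
  simp only [sub_mul, map_sub]
  rw [integral_sub hself hmul, ← hempty, ← huniv]
  linarith

end ExponentialCovariance

section ExponentialMoment

theorem le_mul_exp_of_hasDerivAt_le {u u' : ℝ → ℝ} {v θ : ℝ} (hu : ∀ x, HasDerivAt u (u' x) x)
    (hle : ∀ x, 0 < x → u' x ≤ v * x * u x) (hθ : 0 ≤ θ) :
    u θ ≤ u 0 * Real.exp (v * θ ^ 2 / 2) := by
  have hderiv (x : ℝ) : HasDerivAt (fun x => u x * Real.exp (-(v * x ^ 2 / 2)))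
      ((u' x - v * x * u x) * Real.exp (-(v * x ^ 2 / 2))) x := by
    have hexp := ((((hasDerivAt_pow 2 x).const_mul v).div_const 2).neg).exp
    exact ((hu x).mul hexp).congr_deriv (by simp; ring)
  have hanti : AntitoneOn (fun x => u x * Real.exp (-(v * x ^ 2 / 2))) (Set.Ici 0) := by
    refine antitoneOn_of_deriv_nonpos (convex_Ici 0)
      (fun x _ => (hderiv x).continuousAt.continuousWithinAt)
      (fun x _ => (hderiv x).differentiableAt.differentiableWithinAt) fun x hx => ?_
    rw [interior_Ici] at hx
    rw [(hderiv x).deriv]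
    exact mul_nonpos_of_nonpos_of_nonneg (sub_nonpos.2 (hle x hx)) (Real.exp_pos _).le
  have h := hanti Set.self_mem_Ici hθ hθ
  simp only [Real.exp_neg] at h
  simpa using (mul_inv_le_iff₀ (Real.exp_pos _)).1 h

variable {m : Type*} [Fintype m] [DecidableEq m]

theorem hasDerivAt_reTrace_exp_smul (A : Matrix m m ℂ) (θ : ℝ) :
    HasDerivAt (fun u : ℝ => reTrace (NormedSpace.exp (u • A)))
      (reTrace (A * NormedSpace.exp (θ • A))) θ :=
  reTrace.hasFDerivAt.comp_hasDerivAt θ (hasDerivAt_exp_smul_const' A θ)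

theorem integrable_reTrace_exp_smul {α : Type*} [MeasurableSpace α] {ν : Measure α}
    [IsFiniteMeasure ν] {X : α → Matrix m m ℂ} {R : ℝ} (hX : AEStronglyMeasurable X ν)
    (hR : ∀ᵐ z ∂ν, ‖X z‖ ≤ R) (θ : ℝ) :
    Integrable (fun z => reTrace (NormedSpace.exp (θ • X z))) ν :=
  integrable_comp_of_ae_norm_le hX hR (Φ := fun A => reTrace (NormedSpace.exp (θ • A)))
    (by fun_prop)

theorem hasDerivAt_integral_reTrace_exp_smul {α : Type*} [MeasurableSpace α] {ν : Measure α}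
    [IsFiniteMeasure ν] {X : α → Matrix m m ℂ} {R : ℝ} (hX : AEStronglyMeasurable X ν)
    (hR : ∀ᵐ z ∂ν, ‖X z‖ ≤ R) (θ : ℝ) :
    HasDerivAt (fun u : ℝ => ∫ z, reTrace (NormedSpace.exp (u • X z)) ∂ν)
      (∫ z, reTrace (X z * NormedSpace.exp (θ • X z)) ∂ν) θ := by
  have hcont : Continuous fun p : ℝ × Matrix m m ℂ =>
      reTrace (p.2 * NormedSpace.exp (p.1 • p.2)) := by fun_prop
  obtain ⟨B, hB⟩ := ((isCompact_closedBall θ 1).prod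
    (isCompact_closedBall (0 : Matrix m m ℂ) R)).exists_bound_of_continuousOn hcont.continuousOn
  have hbound : ∀ᵐ z ∂ν, ∀ u ∈ Metric.closedBall θ 1,
      ‖reTrace (X z * NormedSpace.exp (u • X z))‖ ≤ B :=
    hR.mono fun z hz u hu => hB (u, X z) ⟨hu, mem_closedBall_zero_iff.2 hz⟩
  exact (hasDerivAt_integral_of_dominated_loc_of_deriv_le
    (F := fun u z => reTrace (NormedSpace.exp (u • X z)))
    (Metric.closedBall_mem_nhds θ one_pos)
    (.of_forall fun u => (integrable_reTrace_exp_smul hX hR u).aestronglyMeasurable)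
    (integrable_reTrace_exp_smul hX hR θ)
    ((hcont.comp (Continuous.prodMk_right θ)).comp_aestronglyMeasurable hX) hbound
    (integrable_const B) (.of_forall fun z u _ => hasDerivAt_reTrace_exp_smul (X z) u)).2

variable {ι : Type*} [Fintype ι] [DecidableEq ι] {Ω : ι → Type*} [∀ i, MeasurableSpace (Ω i)]
  (μ : ∀ i, Measure (Ω i)) [∀ i, IsProbabilityMeasure (μ i)] {X : (∀ i, Ω i) → Matrix m m ℂ}
  {R v θ : ℝ}

theorem integral_reTrace_mul_exp_smul_le (hX : AEStronglyMeasurable X (Measure.pi μ))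
    (hR : ∀ᵐ z ∂(Measure.pi μ), ‖X z‖ ≤ R) (hherm : ∀ z, (X z).IsHermitian)
    (hmean : ∫ z, X z ∂(Measure.pi μ) = 0)
    (hv : ∀ᵐ z ∂(Measure.pi μ),
      ‖∑ i, ∫ w, (X z - X (Function.update z i (w i))) ^ 2 ∂(Measure.pi μ)‖ ≤ v) (hθ : 0 < θ) :
    ∫ z, reTrace (X z * NormedSpace.exp (θ • X z)) ∂(Measure.pi μ) ≤
      v * θ * ∫ z, reTrace (NormedSpace.exp (θ • X z)) ∂(Measure.pi μ) := by
  have hRθ : ∀ᵐ z ∂(Measure.pi μ), ‖θ • X z‖ ≤ θ * R := hR.mono fun z hz => by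
    rw [norm_smul, Real.norm_of_nonneg hθ.le]
    exact mul_le_mul_of_nonneg_left hz hθ.le
  have hvθ : ∀ᵐ z ∂(Measure.pi μ), ‖∑ i, ∫ w, (θ • X z - θ • X (Function.update z i (w i))) ^ 2
      ∂(Measure.pi μ)‖ ≤ θ ^ 2 * v := hv.mono fun z hz => by
    simp only [← smul_sub, smul_pow, integral_smul, ← Finset.smul_sum]
    rw [norm_smul, norm_pow, Real.norm_of_nonneg hθ.le]
    exact mul_le_mul_of_nonneg_left hz (sq_nonneg θ)
  have h := integral_reTrace_sub_mul_exp_le_mul μ (hX.const_smul θ) hRθ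
    (fun z => (hherm z).smul (.all θ)) hvθ
  simp only [Pi.smul_apply, integral_smul, hmean, smul_zero, sub_zero, smul_mul_assoc, map_smul,
    smul_eq_mul, integral_const_mul] at h
  rw [sq, mul_assoc, mul_assoc, mul_le_mul_iff_right₀ hθ] at h
  linarith

theorem integral_reTrace_exp_smul_le (hX : AEStronglyMeasurable X (Measure.pi μ))
    (hR : ∀ᵐ z ∂(Measure.pi μ), ‖X z‖ ≤ R) (hherm : ∀ z, (X z).IsHermitian)
    (hmean : ∫ z, X z ∂(Measure.pi μ) = 0)
    (hv : ∀ᵐ z ∂(Measure.pi μ),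
      ‖∑ i, ∫ w, (X z - X (Function.update z i (w i))) ^ 2 ∂(Measure.pi μ)‖ ≤ v) (hθ : 0 ≤ θ) :
    ∫ z, reTrace (NormedSpace.exp (θ • X z)) ∂(Measure.pi μ) ≤
      Fintype.card m * Real.exp (v * θ ^ 2 / 2) := by
  have hzero : ∫ z, reTrace (NormedSpace.exp ((0 : ℝ) • X z)) ∂(Measure.pi μ) =
      Fintype.card m := by
    simp [reTrace_apply, Matrix.trace_one]
  rw [← hzero]
  exact le_mul_exp_of_hasDerivAt_le (hasDerivAt_integral_reTrace_exp_smul hX hR)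
    (fun x hx => integral_reTrace_mul_exp_smul_le μ hX hR hherm hmean hv hx) hθ

end ExponentialMoment

section Chernoff

theorem tailBound_top (d : ℕ) (t : ℝ) : tailBound d ⊤ t = d := by
  simp [tailBound, ENNReal.mul_top, ENNReal.div_top]

theorem tailBound_zero_left (d : ℕ) {t : ℝ} (ht : 0 < t) : tailBound d 0 t = 0 := by
  simp [tailBound, ENNReal.div_zero, ht.ne']

theorem tailBound_zero_right (d : ℕ) (v : ℝ≥0∞) : tailBound d v 0 = d := by
  simp [tailBound]

theorem tailBound_coe (d : ℕ) {v : ℝ≥0} (hv : v ≠ 0) (t : ℝ) :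
    tailBound d v t = ENNReal.ofReal (d * Real.exp (-(t ^ 2 / (4 * v)))) := by
  have hdiv : ENNReal.ofReal (t ^ 2) / (4 * v) = ENNReal.ofReal (t ^ 2 / (4 * v)) := by
    rw [ENNReal.ofReal_div_of_pos (by positivity), ENNReal.ofReal_mul (by norm_num)]
    simp
  rw [tailBound, hdiv, EReal.coe_ennreal_ofReal, max_eq_left (by positivity), ← EReal.coe_neg,
    EReal.exp_coe, ENNReal.ofReal_mul (Nat.cast_nonneg d), ENNReal.ofReal_natCast]

theorem expectationBound_top {d : ℕ} (hd : 2 ≤ d) : expectationBound d ⊤ = ⊤ := by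
  have hlog : 0 < Real.log d := Real.log_pos (by exact_mod_cast hd)
  simp [expectationBound, ENNReal.top_mul, hlog]

theorem coe_expectationBound (d : ℕ) (v : ℝ≥0) :
    (expectationBound d v : EReal) = ((2 * √(v * Real.log d) : ℝ) : EReal) := by
  have h : expectationBound d v = ENNReal.ofReal (2 * √(v * Real.log d)) := by
    rw [expectationBound, ← ENNReal.ofReal_coe_nnreal, ← ENNReal.ofReal_mul v.coe_nonneg,
      ENNReal.ofReal_rpow_of_nonneg (by positivity) (by norm_num), Real.sqrt_eq_rpow,
      ENNReal.ofReal_mul (by norm_num), ENNReal.ofReal_ofNat]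
  rw [h, EReal.coe_ennreal_ofReal, max_eq_left (by positivity)]

open ProbabilityTheory Filter

variable {α : Type*} [MeasurableSpace α] {ν : Measure α} {Y : α → ℝ} {d : ℕ} {v : ℝ≥0}

/-- The Laplace transform of `Y` is bounded by `d exp(v θ²)` for `θ ≥ 0`. Unlike in Mathlib's
`HasSubgaussianMGF`, only `θ ≥ 0` is constrained and a prefactor (here the dimension) is allowed;
integrability is required because `mgf` is `0` where the exponential moment is infinite. -/
def HasUpperSubgaussianMGF (Y : α → ℝ) (d : ℕ) (v : ℝ≥0) (ν : Measure α) : Prop :=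
  ∀ θ, 0 ≤ θ → Integrable (fun x => Real.exp (θ * Y x)) ν ∧ mgf Y ν θ ≤ d * Real.exp (v * θ ^ 2)

namespace HasUpperSubgaussianMGF

theorem measureReal_ge_le [IsFiniteMeasure ν]
    (hY : HasUpperSubgaussianMGF Y d v ν) (t : ℝ) {θ : ℝ} (hθ : 0 ≤ θ) :
    ν.real {x | t ≤ Y x} ≤ d * Real.exp (v * θ ^ 2 - θ * t) :=
  calc ν.real {x | t ≤ Y x} ≤ Real.exp (-θ * t) * mgf Y ν θ :=
        measure_ge_le_exp_mul_mgf t hθ (hY θ hθ).1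
    _ ≤ Real.exp (-θ * t) * (d * Real.exp (v * θ ^ 2)) :=
        mul_le_mul_of_nonneg_left (hY θ hθ).2 (Real.exp_pos _).le
    _ = d * Real.exp (v * θ ^ 2 - θ * t) := by
        rw [mul_left_comm, ← Real.exp_add, neg_mul, neg_add_eq_sub]

variable [IsProbabilityMeasure ν] [NeZero d]

theorem measure_ge_le (hY : HasUpperSubgaussianMGF Y d v ν) {t : ℝ} (ht : 0 ≤ t) :
    ν {x | t ≤ Y x} ≤ tailBound d v t := by
  have hchernoff (θ : ℝ) (hθ : 0 ≤ θ) := hY.measureReal_ge_le t hθ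
  rcases ht.eq_or_lt with rfl | ht
  · rw [tailBound_zero_right]
    exact prob_le_one.trans (by exact_mod_cast NeZero.one_le)
  rcases eq_or_ne v 0 with rfl | hv
  · have hlim : Tendsto (fun θ : ℝ => d * Real.exp (0 * θ ^ 2 - θ * t)) atTop (nhds 0) := by
      simpa using (Real.tendsto_exp_neg_atTop_nhds_zero.comp
        (tendsto_id.atTop_mul_const ht)).const_mul (d : ℝ)
    have hzero : ν.real {x | t ≤ Y x} = 0 := measureReal_nonneg.antisymm'
      (ge_of_tendsto hlim ((eventually_ge_atTop 0).mono hchernoff))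
    rw [ENNReal.coe_zero, tailBound_zero_left d ht, (measureReal_eq_zero_iff).1 hzero]
  · have hopt : v * (t / (2 * v)) ^ 2 - t / (2 * v) * t = -(t ^ 2 / (4 * v) : ℝ) := by
      field_simp
      ring
    rw [tailBound_coe d hv, ← ofReal_measureReal, ← hopt]
    exact ENNReal.ofReal_le_ofReal (hchernoff (t / (2 * v)) (by positivity))

theorem integral_le (hY : HasUpperSubgaussianMGF Y d v ν) (hint : Integrable Y ν) :
    ∫ x, Y x ∂ν ≤ 2 * √(v * Real.log d) := by
  rcases le_or_gt (∫ x, Y x ∂ν) 0 with hneg | hpos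
  · exact hneg.trans (by positivity)
  have hlog : 0 ≤ Real.log d := Real.log_natCast_nonneg d
  have hjensen (θ : ℝ) (hθ : 0 ≤ θ) : θ * ∫ x, Y x ∂ν ≤ Real.log d + v * θ ^ 2 := by
    have hd : (0 : ℝ) < d := Nat.cast_pos.2 (NeZero.pos d)
    rw [← Real.exp_le_exp, Real.exp_add, Real.exp_log hd, ← integral_const_mul]
    exact (convexOn_exp.map_integral_le Real.continuous_exp.continuousOn isClosed_univ
      (.of_forall fun _ => Set.mem_univ _) (hint.const_mul θ) (hY θ hθ).1).trans (hY θ hθ).2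
  have hquad (θ : ℝ) : 0 ≤ v * (θ * θ) + -(∫ x, Y x ∂ν) * θ + Real.log d := by
    rcases le_total 0 θ with hθ | hθ
    · linarith [hjensen θ hθ]
    · nlinarith [mul_nonneg v.coe_nonneg (mul_self_nonneg θ)]
  have hdiscrim := discrim_le_zero hquad
  rw [discrim, neg_sq, sub_nonpos, mul_assoc] at hdiscrim
  calc ∫ x, Y x ∂ν ≤ √(4 * (v * Real.log d)) := Real.le_sqrt_of_sq_le hdiscrim
    _ = 2 * √(v * Real.log d) := by
        rw [Real.sqrt_mul (by norm_num), show (4 : ℝ) = 2 ^ 2 by norm_num,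
          Real.sqrt_sq (by norm_num)]

end HasUpperSubgaussianMGF

end Chernoff

section Boundedness

variable {m : Type*} [Fintype m] [DecidableEq m]

theorem reTrace_le_card_mul_norm (M : Matrix m m ℂ) : reTrace M ≤ Fintype.card m * ‖M‖ := by
  have h := reTrace_mul_exp_le Matrix.isHermitian_zero M
  simpa only [NormedSpace.exp_zero, mul_one, reTrace_apply, Matrix.trace_one, Complex.natCast_re,
    mul_comm ‖M‖] using h

theorem norm_le_one_add_reTrace_sq {A : Matrix m m ℂ} (hA : A.IsHermitian) :
    ‖A‖ ≤ 1 + reTrace (A ^ 2) := by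
  nlinarith [sq_norm_le_reTrace_sq hA, sq_nonneg (‖A‖ - 1)]

theorem lintegral_enorm_le_one_add_reTrace {α : Type*} [MeasurableSpace α] {ν : Measure α}
    [IsProbabilityMeasure ν] {X : α → Matrix m m ℂ} (hX : ∀ x, (X x).IsHermitian)
    (hint : Integrable (fun x => X x ^ 2) ν) :
    ∫⁻ x, ‖X x‖ₑ ∂ν ≤ ENNReal.ofReal (1 + reTrace (∫ x, X x ^ 2 ∂ν)) := by
  have htr : Integrable (fun x => reTrace (X x ^ 2)) ν := reTrace.integrable_comp hint
  calc ∫⁻ x, ‖X x‖ₑ ∂ν ≤ ∫⁻ x, ENNReal.ofReal (1 + reTrace (X x ^ 2)) ∂ν := by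
        refine lintegral_mono fun x => ?_
        rw [← ofReal_norm]
        exact ENNReal.ofReal_le_ofReal (norm_le_one_add_reTrace_sq (hX x))
    _ = ENNReal.ofReal (∫ x, (1 + reTrace (X x ^ 2)) ∂ν) :=
        (ofReal_integral_eq_lintegral_ofReal ((integrable_const 1).add htr) (.of_forall fun x =>
          (norm_nonneg _).trans (norm_le_one_add_reTrace_sq (hX x)))).symm
    _ = ENNReal.ofReal (1 + reTrace (∫ x, X x ^ 2 ∂ν)) := by
        rw [integral_add (integrable_const 1) htr, reTrace.integral_comp_comm hint]
        simp

variable {ι : Type*} [Fintype ι] [DecidableEq ι] {Ω : ι → Type*} [∀ i, MeasurableSpace (Ω i)]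
  (μ : ∀ i, Measure (Ω i)) [∀ i, IsProbabilityMeasure (μ i)] {f : (∀ i, Ω i) → Matrix m m ℂ}
  {v : ℝ}

theorem lintegral_enorm_sub_update_le (hherm : ∀ z, (f z).IsHermitian) {z : ∀ i, Ω i}
    (hsq : ∀ i, Integrable (fun w => (f z - f (Function.update z i (w i))) ^ 2) (Measure.pi μ))
    (hv : ‖∑ i, ∫ w, (f z - f (Function.update z i (w i))) ^ 2 ∂(Measure.pi μ)‖ ≤ v) (i : ι) :
    ∫⁻ w, ‖f z - f (Function.update z i (w i))‖ₑ ∂(Measure.pi μ) ≤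
      ENNReal.ofReal (1 + Fintype.card m * v) := by
  have hherm' (j : ι) (w : ∀ i, Ω i) := (hherm z).sub (hherm (Function.update z j (w j)))
  have hnonneg (j : ι) :
      0 ≤ reTrace (∫ w, (f z - f (Function.update z j (w j))) ^ 2 ∂(Measure.pi μ)) := by
    rw [← reTrace.integral_comp_comm (hsq j)]
    exact integral_nonneg fun w => (sq_nonneg _).trans (sq_norm_le_reTrace_sq (hherm' j w))
  refine (lintegral_enorm_le_one_add_reTrace (hherm' i) (hsq i)).trans
    (ENNReal.ofReal_le_ofReal (add_le_add_right ?_ 1))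
  calc reTrace (∫ w, (f z - f (Function.update z i (w i))) ^ 2 ∂(Measure.pi μ))
      ≤ ∑ j, reTrace (∫ w, (f z - f (Function.update z j (w j))) ^ 2 ∂(Measure.pi μ)) :=
        Finset.single_le_sum (fun j _ => hnonneg j) (Finset.mem_univ i)
    _ ≤ Fintype.card m *
          ‖∑ j, ∫ w, (f z - f (Function.update z j (w j))) ^ 2 ∂(Measure.pi μ)‖ := by
        rw [← map_sum]
        exact reTrace_le_card_mul_norm _
    _ ≤ Fintype.card m * v := mul_le_mul_of_nonneg_left hv (Nat.cast_nonneg _)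

theorem exists_ae_norm_le (hherm : ∀ z, (f z).IsHermitian) (hf : Integrable f (Measure.pi μ))
    (hsq : ∀ᵐ z ∂(Measure.pi μ), ∀ i,
      Integrable (fun w => (f z - f (Function.update z i (w i))) ^ 2) (Measure.pi μ))
    (hv : ∀ᵐ z ∂(Measure.pi μ),
      ‖∑ i, ∫ w, (f z - f (Function.update z i (w i))) ^ 2 ∂(Measure.pi μ)‖ ≤ v) :
    ∃ R, ∀ᵐ z ∂(Measure.pi μ), ‖f z‖ ≤ R := by
  have hinc := (hsq.and hv).mono fun z hz => lintegral_enorm_sub_update_le μ hherm hz.1 hz.2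
  have hfin : ∫⁻ w, ‖f w‖ₑ ∂(Measure.pi μ) +
      Fintype.card ι * ENNReal.ofReal (1 + Fintype.card m * v) ≠ ∞ :=
    ENNReal.add_ne_top.2 ⟨hf.2.ne, by finiteness⟩
  exact ⟨_, (ae_enorm_le_lintegral_enorm_add μ hf.1 hinc).mono fun z hz =>
    (toReal_enorm (f z)).symm.trans_le (ENNReal.toReal_mono hfin hz)⟩

end Boundedness

section LargestEigenvalue

theorem isHermitian_sub_integral {α m : Type*} [MeasurableSpace α] {ν : Measure α} [Fintype m]
    [DecidableEq m] {X : α → Matrix m m ℂ} (hherm : ∀ x, (X x).IsHermitian) (x : α) :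
    (X x - ∫ y, X y ∂ν).IsHermitian := by
  refine (hherm x).sub ?_
  have h : ∫ y, star (X y) ∂ν = star (∫ y, X y ∂ν) :=
    (starL' ℝ (A := Matrix m m ℂ)).integral_comp_comm X
  simp only [(hherm _).isSelfAdjoint.star_eq] at h
  exact h.symm

variable {ι : Type*} [Fintype ι] [DecidableEq ι] {Ω : ι → Type*} [∀ i, MeasurableSpace (Ω i)]
  (μ : ∀ i, Measure (Ω i)) [∀ i, IsProbabilityMeasure (μ i)] {d : ℕ} [NeZero d]
  {f : (∀ i, Ω i) → Matrix (Fin d) (Fin d) ℂ} {R v θ : ℝ}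

theorem integrable_exp_mul_lambdaMax {α : Type*} [MeasurableSpace α] {ν : Measure α}
    [IsFiniteMeasure ν] {X : α → Matrix (Fin d) (Fin d) ℂ} (hX : AEStronglyMeasurable X ν)
    (hR : ∀ᵐ x ∂ν, ‖X x‖ ≤ R) (hherm : ∀ x, (X x).IsHermitian) (hθ : 0 ≤ θ) :
    Integrable (fun x => Real.exp (θ * lambdaMax (X x))) ν := by
  refine (integrable_reTrace_exp_smul hX hR θ).mono'
    (Real.continuous_exp.comp_aestronglyMeasurable
      ((aestronglyMeasurable_lambdaMax hX hherm).const_mul θ)) (.of_forall fun x => ?_)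
  rw [Real.norm_of_nonneg (Real.exp_pos _).le]
  exact exp_mul_lambdaMax_le_reTrace_exp (hherm x) hθ

theorem mgf_lambdaMax_sub_integral_le (hf : AEStronglyMeasurable f (Measure.pi μ))
    (hR : ∀ᵐ z ∂(Measure.pi μ), ‖f z‖ ≤ R) (hherm : ∀ z, (f z).IsHermitian)
    (hv : ∀ᵐ z ∂(Measure.pi μ),
      ‖∑ i, ∫ w, (f z - f (Function.update z i (w i))) ^ 2 ∂(Measure.pi μ)‖ ≤ 2 * v)
    (hθ : 0 ≤ θ) :
    ProbabilityTheory.mgf (fun z => lambdaMax (f z - ∫ w, f w ∂(Measure.pi μ))) (Measure.pi μ) θ ≤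
      d * Real.exp (v * θ ^ 2) := by
  set E := ∫ w, f w ∂(Measure.pi μ)
  have hX : AEStronglyMeasurable (fun z => f z - E) (Measure.pi μ) :=
    hf.sub aestronglyMeasurable_const
  have hXherm (z : ∀ i, Ω i) : (f z - E).IsHermitian := isHermitian_sub_integral hherm z
  have hXR : ∀ᵐ z ∂(Measure.pi μ), ‖f z - E‖ ≤ R + ‖E‖ :=
    hR.mono fun z hz => (norm_sub_le _ _).trans (add_le_add_left hz _)
  have hmean : ∫ z, (f z - E) ∂(Measure.pi μ) = 0 := by
    rw [integral_sub (.of_bound hf R hR) (integrable_const E), integral_const, probReal_univ,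
      one_smul, sub_self]
  calc _ ≤ ∫ z, reTrace (NormedSpace.exp (θ • (f z - E))) ∂(Measure.pi μ) :=
        integral_mono (integrable_exp_mul_lambdaMax hX hXR hXherm hθ)
          (integrable_reTrace_exp_smul hX hXR θ)
          fun z => exp_mul_lambdaMax_le_reTrace_exp (hXherm z) hθ
    _ ≤ Fintype.card (Fin d) * Real.exp (2 * v * θ ^ 2 / 2) :=
        integral_reTrace_exp_smul_le μ hX hXR hXherm hmean
          (by simpa only [sub_sub_sub_cancel_right] using hv) hθ
    _ = d * Real.exp (v * θ ^ 2) := by rw [Fintype.card_fin]; ring_nf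

end LargestEigenvalue

section Concentration

variable {d : ℕ}

section Expectation

variable {α : Type*} [MeasurableSpace α] {ν : Measure α} {X : α → Matrix (Fin d) (Fin d) ℂ}

theorem EntryIntegrable.integrable (hX : EntryIntegrable ν X) : Integrable X ν :=
  (Matrix.ofLinearEquiv ℂ).toLinearMap.toContinuousLinearMap.integrable_comp
    (.of_eval fun a => .of_eval fun b => hX a b)

theorem expect_eq_integral (hX : EntryIntegrable ν X) : expect ν X = ∫ x, X x ∂ν := by
  ext a b
  exact (Matrix.entryLinearMap ℂ ℂ a b).toContinuousLinearMap.integral_comp_comm hX.integrable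

theorem expect_neg (ν : Measure α) (X : α → Matrix (Fin d) (Fin d) ℂ) :
    expect ν (fun x => -X x) = -expect ν X := by
  ext a b
  exact integral_neg _

variable [NeZero d]

theorem integrable_lambdaMax_sub_expect [IsFiniteMeasure ν] (hX : EntryIntegrable ν X)
    (hherm : ∀ x, (X x).IsHermitian) : Integrable (fun x => lambdaMax (X x - expect ν X)) ν := by
  rw [expect_eq_integral hX]
  have hint : Integrable (fun x => X x - ∫ y, X y ∂ν) ν := hX.integrable.sub (integrable_const _)
  have hherm' := isHermitian_sub_integral (ν := ν) hherm
  exact hint.norm.mono' (aestronglyMeasurable_lambdaMax hint.1 hherm')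
    (.of_forall fun x => abs_lambdaMax_le_norm (hherm' x))

theorem integral_lambdaMax_sub_expect_eq_zero [IsProbabilityMeasure ν] [Subsingleton (Fin d)]
    (hX : EntryIntegrable ν X) (hherm : ∀ x, (X x).IsHermitian) :
    ∫ x, lambdaMax (X x - expect ν X) ∂ν = 0 := by
  rw [expect_eq_integral hX]
  have hint : Integrable (fun x => X x - ∫ y, X y ∂ν) ν := hX.integrable.sub (integrable_const _)
  simp only [lambdaMax_eq_reTrace (isHermitian_sub_integral hherm _)]
  rw [reTrace.integral_comp_comm hint, integral_sub hX.integrable (integrable_const _),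
    integral_const, probReal_univ, one_smul, sub_self, map_zero]

end Expectation

variable {n : ℕ} {Ω : Fin n → Type*}

theorem sqIncrement_neg (f : (∀ i, Ω i) → Matrix (Fin d) (Fin d) ℂ) (i : Fin n)
    (z w : ∀ i, Ω i) : sqIncrement (fun z => -f z) i z w = sqIncrement f i z w := by
  rw [sqIncrement, sqIncrement, ← neg_sq, neg_sub_neg, neg_sub]

variable [∀ i, MeasurableSpace (Ω i)]

theorem varianceProxy_neg (μ : ∀ i, Measure (Ω i))
    (f : (∀ i, Ω i) → Matrix (Fin d) (Fin d) ℂ) :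
    varianceProxy μ (fun z => -f z) = varianceProxy μ f := by
  simp only [varianceProxy, varianceMatrix, sqIncrement_neg]

variable {μ : ∀ i, Measure (Ω i)} {f : (∀ i, Ω i) → Matrix (Fin d) (Fin d) ℂ} {v : ℝ≥0}

theorem norm_sum_integral_sq_eq {z : ∀ i, Ω i}
    (hsq : ∀ i, EntryIntegrable (Measure.pi μ) (sqIncrement f i z)) :
    ‖∑ i, ∫ w, (f z - f (Function.update z i (w i))) ^ 2 ∂(Measure.pi μ)‖ =
      2 * ‖Matrix.toEuclideanCLM (n := Fin d) (𝕜 := ℂ) (varianceMatrix μ f z)‖ := by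
  rw [← Matrix.cstar_norm_def, varianceMatrix, norm_smul,
    Finset.sum_congr rfl fun i _ => expect_eq_integral (hsq i)]
  simp [sqIncrement]

theorem ae_norm_sum_integral_sq_le
    (hsq : ∀ᵐ z ∂(Measure.pi μ), ∀ i, EntryIntegrable (Measure.pi μ) (sqIncrement f i z))
    (hv : varianceProxy μ f ≤ v) :
    ∀ᵐ z ∂(Measure.pi μ),
      ‖∑ i, ∫ w, (f z - f (Function.update z i (w i))) ^ 2 ∂(Measure.pi μ)‖ ≤ 2 * (v : ℝ) := by
  filter_upwards [hsq, ae_le_essSup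
    (f := fun z => ‖Matrix.toEuclideanCLM (n := Fin d) (𝕜 := ℂ) (varianceMatrix μ f z)‖ₑ)]
    with z hz hle
  rw [norm_sum_integral_sq_eq hz]
  have h : ‖Matrix.toEuclideanCLM (n := Fin d) (𝕜 := ℂ) (varianceMatrix μ f z)‖ₑ ≤ v :=
    hle.trans hv
  exact mul_le_mul_of_nonneg_left (NNReal.coe_le_coe.2 (ENNReal.coe_le_coe.1 h)) zero_le_two

variable [∀ i, IsProbabilityMeasure (μ i)] [NeZero d]

theorem hasUpperSubgaussianMGF_lambdaMax_sub_expect (hherm : ∀ z, (f z).IsHermitian)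
    (hf : EntryIntegrable (Measure.pi μ) f)
    (hsq : ∀ᵐ z ∂(Measure.pi μ), ∀ i, EntryIntegrable (Measure.pi μ) (sqIncrement f i z))
    (hv : varianceProxy μ f ≤ v) :
    HasUpperSubgaussianMGF (fun z => lambdaMax (f z - expect (Measure.pi μ) f)) d v
      (Measure.pi μ) := by
  intro θ hθ
  rw [expect_eq_integral hf]
  have hv2 := ae_norm_sum_integral_sq_le hsq hv
  have hfi := hf.integrable
  obtain ⟨R, hR⟩ := exists_ae_norm_le μ hherm hfi (hsq.mono fun z hz i => (hz i).integrable) hv2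
  exact ⟨integrable_exp_mul_lambdaMax (hfi.1.sub aestronglyMeasurable_const)
    (hR.mono fun z hz => (norm_sub_le _ _).trans (add_le_add_left hz _))
    (isHermitian_sub_integral hherm) hθ, mgf_lambdaMax_sub_integral_le μ hfi.1 hR hherm hv2 hθ⟩

theorem measure_ge_lambdaMax_sub_expect_le (hherm : ∀ z, (f z).IsHermitian)
    (hf : EntryIntegrable (Measure.pi μ) f)
    (hsq : ∀ᵐ z ∂(Measure.pi μ), ∀ i, EntryIntegrable (Measure.pi μ) (sqIncrement f i z))
    {t : ℝ} (ht : 0 ≤ t) :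
    Measure.pi μ {z | t ≤ lambdaMax (f z - expect (Measure.pi μ) f)} ≤
      tailBound d (varianceProxy μ f) t := by
  cases hv : varianceProxy μ f with
  | top =>
    rw [tailBound_top]
    exact prob_le_one.trans (by exact_mod_cast NeZero.one_le)
  | coe v => exact (hasUpperSubgaussianMGF_lambdaMax_sub_expect hherm hf hsq hv.le).measure_ge_le ht

theorem integral_lambdaMax_sub_expect_le (hherm : ∀ z, (f z).IsHermitian)
    (hf : EntryIntegrable (Measure.pi μ) f)
    (hsq : ∀ᵐ z ∂(Measure.pi μ), ∀ i, EntryIntegrable (Measure.pi μ) (sqIncrement f i z)) :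
    ((∫ z, lambdaMax (f z - expect (Measure.pi μ) f) ∂(Measure.pi μ) : ℝ) : EReal) ≤
      expectationBound d (varianceProxy μ f) := by
  cases hv : varianceProxy μ f with
  | top =>
    rcases subsingleton_or_nontrivial (Fin d) with _ | hd
    · rw [integral_lambdaMax_sub_expect_eq_zero hf hherm]
      exact EReal.coe_ennreal_nonneg _
    · rw [expectationBound_top (Fin.nontrivial_iff_two_le.1 hd)]
      exact le_top
  | coe v =>
    rw [coe_expectationBound, EReal.coe_le_coe_iff]
    exact (hasUpperSubgaussianMGF_lambdaMax_sub_expect hherm hf hsq hv.le).integral_le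
      (integrable_lambdaMax_sub_expect hf hherm)

end Concentration

end ProductMatrix

end

theorem corollary3p5 {n d : ℕ} (hd : 1 ≤ d)
    {Ω : Fin n → Type*} [∀ i, MeasurableSpace (Ω i)]
    (μ : ∀ i, Measure (Ω i)) [∀ i, IsProbabilityMeasure (μ i)]
    (f : (∀ i, Ω i) → Matrix (Fin d) (Fin d) ℂ)
    (hf_herm : ∀ z, (f z).IsHermitian)
    (hf_int : ProductMatrix.EntryIntegrable (Measure.pi μ) f)
    (hV : ∀ᵐ z ∂(Measure.pi μ), ∀ i,
      ProductMatrix.EntryIntegrable (Measure.pi μ) (fun w => ProductMatrix.sqIncrement f i z w)) :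
    (∀ t : ℝ, 0 ≤ t →
      Measure.pi μ {z | t ≤ ProductMatrix.lambdaMax (f z - ProductMatrix.expect (Measure.pi μ) f)}
        ≤ ProductMatrix.tailBound d (ProductMatrix.varianceProxy μ f) t) ∧
    (Integrable (fun z => ProductMatrix.lambdaMax (f z - ProductMatrix.expect (Measure.pi μ) f))
        (Measure.pi μ) ∧
      ((∫ z, ProductMatrix.lambdaMax (f z - ProductMatrix.expect (Measure.pi μ) f)
          ∂(Measure.pi μ) : ℝ) : EReal)
        ≤ (ProductMatrix.expectationBound d (ProductMatrix.varianceProxy μ f) : EReal)) ∧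
    (∀ t : ℝ, 0 ≤ t →
      Measure.pi μ {z | ProductMatrix.lambdaMin (f z - ProductMatrix.expect (Measure.pi μ) f) ≤ -t}
        ≤ ProductMatrix.tailBound d (ProductMatrix.varianceProxy μ f) t) ∧
    (Integrable (fun z => ProductMatrix.lambdaMin (f z - ProductMatrix.expect (Measure.pi μ) f))
        (Measure.pi μ) ∧
      -(ProductMatrix.expectationBound d (ProductMatrix.varianceProxy μ f) : EReal)
        ≤ ((∫ z, ProductMatrix.lambdaMin (f z - ProductMatrix.expect (Measure.pi μ) f)
          ∂(Measure.pi μ) : ℝ) : EReal)) := by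
  have : NeZero d := ⟨Nat.one_le_iff_ne_zero.1 hd⟩
  have hg_herm (z : ∀ i, Ω i) : (-f z).IsHermitian := (hf_herm z).neg
  have hg_int : ProductMatrix.EntryIntegrable (Measure.pi μ) fun z => -f z :=
    fun a b => (hf_int a b).neg
  have hgV : ∀ᵐ z ∂(Measure.pi μ), ∀ i, ProductMatrix.EntryIntegrable (Measure.pi μ)
      (fun w => ProductMatrix.sqIncrement (fun z => -f z) i z w) := by
    simpa only [ProductMatrix.sqIncrement_neg] using hV
  have hmin (z : ∀ i, Ω i) : ProductMatrix.lambdaMin (f z - ProductMatrix.expect (Measure.pi μ) f) =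
      -ProductMatrix.lambdaMax (-f z - ProductMatrix.expect (Measure.pi μ) fun z => -f z) := by
    rw [ProductMatrix.lambdaMin_eq_neg_lambdaMax_neg, ProductMatrix.expect_neg, neg_sub,
      neg_sub_neg]
  refine ⟨fun t ht => ProductMatrix.measure_ge_lambdaMax_sub_expect_le hf_herm hf_int hV ht,
    ⟨ProductMatrix.integrable_lambdaMax_sub_expect hf_int hf_herm,
      ProductMatrix.integral_lambdaMax_sub_expect_le hf_herm hf_int hV⟩, ?_⟩
  simp only [hmin, neg_le_neg_iff, integral_neg, EReal.coe_neg, EReal.neg_le_neg_iff,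
    ← ProductMatrix.varianceProxy_neg μ f]
  exact ⟨fun t ht => ProductMatrix.measure_ge_lambdaMax_sub_expect_le hg_herm hg_int hgV ht,
    (ProductMatrix.integrable_lambdaMax_sub_expect hg_int hg_herm).neg,
    ProductMatrix.integral_lambdaMax_sub_expect_le hg_herm hg_int hgV⟩
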